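/- Let $p$ be an odd prime. A finite $p$-group $G$ is called thin if every antichain in the lattice of its normal subgroups (that is, every set of pairwise incomparable normal subgroups of $G$) has at most $p+1$ elements. Let $G$ be a finite thin $p$-group with $|G| > p$. Then $G$ has a non-inner automorphism of order $p$. -/

import Mathlib

/-- A finite group `G` is a thin `p`-group if it is a `p`-group and every antichain in its lattice of
normal subgroups, i.e. every set of pairwise incomparable normal subgroups, has at most
`p + 1` elements. -/
structure IsThinPGroup (p : ℕ) (G : Type*) [Group G] : Prop where
  finite : Finite G
  isPGroup : IsPGroup p G
  card_antichain_le : ∀ S : Finset (Subgroup G), (∀ N ∈ S, N.Normal) →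
    IsAntichain (· ≤ ·) (S : Set (Subgroup G)) → S.card ≤ p + 1

/-- An automorphism is inner if it is conjugation by an element of the group. -/
def IsInnerAut {G : Type*} [Group G] (φ : MulAut G) : Prop :=
  ∃ h : G, ∀ g : G, φ g = h * g * h⁻¹

namespace ThinPGroup

open scoped commutatorElement

/-! ### Powers and membership in subgroups. -/

section Elementary

variable {G : Type*} [Group G] {p : ℕ}

/-! Write γ_i for `lcs G i`, so that γ_0 = G and γ_1 = G'. Thinness enters through one absorption
principle, `mem_of_central_independent`: given independent central elements x, z of order p, an
element outside ⟨x, z⟩ that is central of order dividing p modulo ⟨z⟩ would yield p + 2 pairwise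
incomparable normal subgroups. Applied to quotients, which are again thin, it shows for nonabelian G
that G/γ_1 has exponent p and two generators (`exists_generators`) and that every normal subgroup is
comparable with every γ_i (`le_lcs_or_lcs_le`).

Candidate automorphisms come from `exists_mulAut_orderOf_eq`: fix a maximal subgroup M pointwise and
send c ∉ M to cu, where u ∈ Z(M) has order p and (cu)^p = c^p. If all automorphisms of order p are
inner, each such twist is conjugation by some x that centralizes M. For class at most two a suitable
u contradicts this at once.

For class at least three, let γ_{n+2} be the last nontrivial term. Twisting by an element of γ_{n+2}
produces a noncentral x in the second centre that centralizes M, and comparability of ⟨x⟩Z(G) with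
γ_{n+1} turns it into a noncentral u ∈ γ_{n+1} that centralizes M. Since γ_{n+1} has exponent p
(`pow_eq_one_of_mem_lcs`), one can twist by u as well, and the new conjugator lies in the third
centre but not in the second. For generators a, b, the maximal subgroups containing a, b and ab give
three such conjugators. By absorption the third is a product of powers of the first two modulo the
second centre; since it commutes with ab, both exponents are divisible by p, so it lies in the
second centre, a contradiction. -/

theorem mem_of_pow_mem_of_zpow_mem (hp : p.Prime) {H : Subgroup G} {g : G} {m : ℤ}
    (h1 : g ^ p ∈ H) (h2 : g ^ m ∈ H) (hm : ¬ (p : ℤ) ∣ m) : g ∈ H := by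
  have hc : IsCoprime (p : ℤ) m :=
    (Prime.coprime_iff_not_dvd (Nat.prime_iff_prime_int.mp hp)).mpr hm
  obtain ⟨r, s, hrs⟩ := hc
  have : g = (g ^ p) ^ r * (g ^ m) ^ s := by
    rw [← zpow_natCast g p, ← zpow_mul, ← zpow_mul, ← zpow_add]
    rw [show (p : ℤ) * r + m * s = 1 by linarith, zpow_one]
  rw [this]
  exact H.mul_mem (H.zpow_mem h1 _) (H.zpow_mem h2 _)

theorem zpow_mem_of_pow_mem {H : Subgroup G} {g : G} {m : ℤ}
    (h1 : g ^ p ∈ H) (hm : (p : ℤ) ∣ m) : g ^ m ∈ H := by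
  obtain ⟨k, rfl⟩ := hm
  rw [zpow_mul, zpow_natCast]
  exact H.zpow_mem h1 _

theorem mem_of_pow_mem_imp_mem (hG : IsPGroup p G) {H : Subgroup G}
    (h : ∀ g, g ^ p ∈ H → g ∈ H) (g : G) : g ∈ H := by
  obtain ⟨k, hk⟩ := hG g
  induction k generalizing g with
  | zero => simp at hk; simp [hk, H.one_mem]
  | succ k ih =>
    refine h g (ih _ ?_)
    rw [← pow_mul, ← pow_succ', hk]

/-- Commuting up to a central element of order dividing an odd prime does not affect `p`-th powers
of products. -/
theorem mul_pow_of_commutator_central (hp : p.Prime) (hodd : Odd p) {w g s : G}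
    (hs : g * w = s * w * g) (hsw : Commute s w) (hsg : Commute s g) (hsp : s ^ p = 1) :
    (w * g) ^ p = w ^ p * g ^ p := by
  have h1 : ∀ n : ℕ, g ^ n * w = s ^ n * w * g ^ n := by
    intro n
    induction n with
    | zero => simp
    | succ n ih =>
      calc g ^ (n + 1) * w = g ^ n * (g * w) := by rw [pow_succ, mul_assoc]
        _ = (g ^ n * s) * w * g := by rw [hs]; simp only [mul_assoc]
        _ = s * (g ^ n * w) * g := by rw [← (hsg.pow_right n).eq]; simp only [mul_assoc]
        _ = s ^ (n + 1) * w * g ^ (n + 1) := by rw [ih, pow_succ', pow_succ g]; simp only [mul_assoc]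
  have h2 : ∀ n : ℕ, (w * g) ^ n = s ^ (n.choose 2) * w ^ n * g ^ n := by
    intro n
    induction n with
    | zero => simp
    | succ n ih =>
      have e : s ^ ((n + 1).choose 2) = s ^ (n.choose 2) * s ^ n := by
        rw [← pow_add, Nat.choose_succ_succ' n 1, Nat.choose_one_right, add_comm]
      calc (w * g) ^ (n + 1) = s ^ (n.choose 2) * w ^ n * (g ^ n * w) * g := by
            rw [pow_succ, ih]; simp only [mul_assoc]
        _ = s ^ (n.choose 2) * (w ^ n * s ^ n) * w * g ^ n * g := by
            rw [h1]; simp only [mul_assoc]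
        _ = _ := by
            rw [← (hsw.pow_pow n n).eq, e, pow_succ w, pow_succ g]; simp only [mul_assoc]
  -- The only place where oddness of p is used.
  have h3 : s ^ (p.choose 2) = 1 := by
    have : p ∣ p.choose 2 := by
      refine hp.dvd_choose_self (by norm_num) ?_
      rcases hp.two_le.eq_or_lt with h | h
      · rw [← h] at hodd; exact absurd hodd (by decide)
      · exact h
    obtain ⟨k, hk⟩ := this
    rw [hk, pow_mul, hsp, one_pow]
  rw [h2, h3, one_mul]

end Elementary

/-! ### Thinness, quotients and the absorption principle. -/

section Antichain

variable {G : Type*} [Group G] {p : ℕ}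

theorem card_le_of_pairwise_not_le (hG : IsThinPGroup p G) {ι : Type*} [Fintype ι]
    (f : ι → Subgroup G) (hn : ∀ i, (f i).Normal) (hf : ∀ i j, f i ≤ f j → i = j) :
    Fintype.card ι ≤ p + 1 := by
  classical
  have hinj : Function.Injective f := fun i j h => hf i j h.le
  have := hG.card_antichain_le (Finset.univ.image f)
    (by simp only [Finset.mem_image, Finset.mem_univ, true_and]; rintro N ⟨i, rfl⟩; exact hn i)
    (by
      intro A hA B hB hne hle
      simp only [Finset.coe_image, Finset.coe_univ, Set.image_univ, Set.mem_range] at hA hB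
      obtain ⟨i, rfl⟩ := hA
      obtain ⟨j, rfl⟩ := hB
      exact hne (congrArg f (hf i j hle)))
  rwa [Finset.card_image_of_injective _ hinj, Finset.card_univ] at this

theorem isThinPGroup_quotient (hG : IsThinPGroup p G) (K : Subgroup G) [K.Normal] :
    IsThinPGroup p (G ⧸ K) where
  finite := by have := hG.finite; infer_instance
  isPGroup := hG.isPGroup.to_quotient K
  card_antichain_le S hS hanti := by
    have hsurj := QuotientGroup.mk'_surjective K
    have := card_le_of_pairwise_not_le hG
      (fun N : S => (N : Subgroup (G ⧸ K)).comap (QuotientGroup.mk' K))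
      (fun N => (hS N N.2).comap _)
      (fun N M h => by
        by_contra hne
        exact hanti N.2 M.2 (fun h => hne (Subtype.ext h))
          ((Subgroup.comap_le_comap_of_surjective hsurj).mp h))
    simpa using this

theorem normal_zpowers_of_mem_center {x : G} (hx : x ∈ Subgroup.center G) :
    (Subgroup.zpowers x).Normal := by
  refine ⟨fun n hn g => ?_⟩
  have : n ∈ Subgroup.center G := (Subgroup.zpowers_le.mpr hx) hn
  rw [Subgroup.mem_center_iff.mp this g, mul_inv_cancel_right]
  exact hn

theorem commute_of_mem_center {x : G} (hx : x ∈ Subgroup.center G) (g : G) : Commute x g :=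
  (Subgroup.mem_center_iff.mp hx g).symm

/-- Modulo `N` the element `g` is central, hence so is everything it generates. -/
theorem normal_zpowers_sup {g : G} {N : Subgroup G} [N.Normal]
    (h : ∀ t : G, ⁅t, g⁆ ∈ N) : (Subgroup.zpowers g ⊔ N).Normal := by
  rw [← Subgroup.commutator_top_left_le_iff, Subgroup.commutator_le]
  intro t _ n hn
  have : (⁅t, n⁆ : G) ∈ N := by
    have key : QuotientGroup.mk' N n ∈ Subgroup.center (G ⧸ N) := by
      have h1 : (Subgroup.zpowers g ⊔ N) ≤
          (Subgroup.center (G ⧸ N)).comap (QuotientGroup.mk' N) := by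
        rw [sup_le_iff, Subgroup.zpowers_le]
        constructor
        · rw [Subgroup.mem_comap, Subgroup.mem_center_iff]
          intro q
          obtain ⟨t, rfl⟩ := QuotientGroup.mk'_surjective N q
          rw [← commutatorElement_eq_one_iff_mul_comm, ← map_commutatorElement]
          exact (QuotientGroup.eq_one_iff _).mpr (h t)
        · intro n hn
          rw [Subgroup.mem_comap, QuotientGroup.mk'_apply, (QuotientGroup.eq_one_iff n).mpr hn]
          exact Subgroup.one_mem _
      exact h1 hn
    have h2 := Subgroup.mem_center_iff.mp key (QuotientGroup.mk' N t)
    rw [← commutatorElement_eq_one_iff_mul_comm, ← map_commutatorElement] at h2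
    exact (QuotientGroup.eq_one_iff _).mp h2
  exact (le_sup_right : N ≤ _) this

/-- In a thin group, two independent central elements of order `p` absorb every element that is
central of order `p` modulo one of them. -/
theorem mem_of_central_independent (hp : p.Prime) (hG : IsThinPGroup p G) {x z y : G}
    (hx : x ∈ Subgroup.center G) (hz : z ∈ Subgroup.center G)
    (hxp : x ^ p = 1) (hzp : z ^ p = 1) (hz1 : z ≠ 1) (hxz : x ∉ Subgroup.zpowers z)
    (hyp : y ^ p ∈ Subgroup.zpowers z) (hyc : ∀ g : G, ⁅g, y⁆ ∈ Subgroup.zpowers z) :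
    y ∈ Subgroup.zpowers x ⊔ Subgroup.zpowers z := by
  by_contra hy
  set W := Subgroup.zpowers x ⊔ Subgroup.zpowers z with hW
  set Z := Subgroup.zpowers z with hZ
  have hxW : x ∈ W := (le_sup_left : _ ≤ W) (Subgroup.mem_zpowers x)
  have hZW : Z ≤ W := le_sup_right
  have hzZ : z ∈ Z := Subgroup.mem_zpowers z
  have hypW : y ^ p ∈ W := hZW hyp
  have : Z.Normal := normal_zpowers_of_mem_center hz
  have cx : ∀ g, Commute x g := commute_of_mem_center hx
  have cz : ∀ g, Commute z g := commute_of_mem_center hz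
  have hcyx : ∀ (j : ℕ) (g : G), ⁅g, y * x ^ j⁆ ∈ Z := by
    intro j g
    have : (⁅g, y * x ^ j⁆ : G) = ⁅g, y⁆ := by
      have h1 : (x ^ j) * g = g * x ^ j := ((cx g).pow_left j).eq
      simp only [commutatorElement_def, mul_inv_rev]
      rw [show g * (y * x ^ j) * g⁻¹ * ((x ^ j)⁻¹ * y⁻¹) =
        g * y * (x ^ j * g⁻¹) * (x ^ j)⁻¹ * y⁻¹ by group, ((cx g⁻¹).pow_left j).eq]
      group
    rw [this]; exact hyc g
  -- The antichain consists of the p subgroups ⟨y x^j⟩Z, each meeting W only inside Z, and of ⟨x⟩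
  -- and ⟨xz⟩, which lie in W but not in Z.
  let Y : ℕ → Subgroup G := fun j => Subgroup.zpowers (y * x ^ j) ⊔ Z
  have hmemY : ∀ (j : ℕ) g, g ∈ Y j → ∃ m : ℤ, ∃ l ∈ Z, g = y ^ m * x ^ (j * m) * l := by
    intro j g hg
    obtain ⟨a, ha, l, hl, rfl⟩ := Subgroup.mem_sup_of_normal_right.mp hg
    obtain ⟨m, rfl⟩ := Subgroup.mem_zpowers_iff.mp ha
    refine ⟨m, l, hl, ?_⟩
    rw [(((cx y).pow_left j).symm).mul_zpow, ← zpow_natCast x j, ← zpow_mul]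
  have hyx : ∀ j : ℕ, y * x ^ j ∉ W := by
    intro j h
    exact hy ((W.mul_mem_cancel_right (W.pow_mem hxW j)).mp h)
  have hxpZ : x ^ p ∈ Z := hxp ▸ Z.one_mem
  have hYW : ∀ (j : ℕ) g, g ∈ Y j → g ∈ W → g ∈ Z := by
    intro j g hg hgW
    obtain ⟨m, l, hl, rfl⟩ := hmemY j g hg
    have hym : y ^ m ∈ W :=
      (W.mul_mem_cancel_right (W.zpow_mem hxW _)).mp ((W.mul_mem_cancel_right (hZW hl)).mp hgW)
    have hpm : (p : ℤ) ∣ m := by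
      by_contra hpm
      exact hy (mem_of_pow_mem_of_zpow_mem hp hypW hym hpm)
    exact Z.mul_mem (Z.mul_mem (zpow_mem_of_pow_mem hyp hpm)
      (zpow_mem_of_pow_mem hxpZ (hpm.mul_left _))) hl
  let X : Bool → Subgroup G := fun b => Subgroup.zpowers (x * cond b 1 z)
  have hbz : ∀ b : Bool, cond b 1 z ∈ Z := by rintro (_ | _) <;> simp [hzZ, Z.one_mem]
  have hXW : ∀ b, X b ≤ W := fun b =>
    Subgroup.zpowers_le.mpr (W.mul_mem hxW (hZW (hbz b)))
  have hXZ : ∀ b, x * cond b 1 z ∉ Z := fun b h => hxz ((Z.mul_mem_cancel_right (hbz b)).mp h)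
  have hXX : ∀ b b', X b ≤ X b' → b = b' := by
    intro b b' h
    have h1 : x * cond b 1 z ∈ X b' := h (Subgroup.mem_zpowers _)
    obtain ⟨m, hm⟩ := Subgroup.mem_zpowers_iff.mp h1
    rw [(cx _).mul_zpow] at hm
    have hd : cond b' 1 z ^ m ∈ Z := Z.zpow_mem (hbz b') m
    have h3 : x ^ (m - 1) * cond b' 1 z ^ m = cond b 1 z := by
      rw [sub_eq_neg_add, zpow_add, zpow_neg_one, mul_assoc, hm, inv_mul_cancel_left]
    have h4 : x ^ (m - 1) ∈ Z := (Z.mul_mem_cancel_right hd).mp (h3 ▸ hbz b)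
    have h5 : (p : ℤ) ∣ m - 1 := by
      by_contra hpm
      exact hxz (mem_of_pow_mem_of_zpow_mem hp hxpZ h4 hpm)
    have h6 : x ^ (m - 1) = 1 := by
      obtain ⟨k, hk⟩ := h5
      rw [hk, zpow_mul, zpow_natCast, hxp, one_zpow]
    have h7 : z ^ (m - 1) = 1 := by
      obtain ⟨k, hk⟩ := h5
      rw [hk, zpow_mul, zpow_natCast, hzp, one_zpow]
    have h8 : z ^ m = z := by rw [zpow_sub_one, mul_inv_eq_one] at h7; exact h7
    rw [h6, one_mul] at h3
    rcases b with _ | _ <;> rcases b' with _ | _ <;> simp_all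
  let f : Fin p ⊕ Bool → Subgroup G := Sum.elim (fun j => Y j) X
  have := card_le_of_pairwise_not_le hG f ?_ ?_
  · simp at this
  · rintro (j | b)
    · exact normal_zpowers_sup (hcyx j)
    · refine normal_zpowers_of_mem_center (Subgroup.mul_mem _ hx ?_)
      exact (Subgroup.zpowers_le.mpr hz) (hbz b)
  · rintro (j | b) (k | b') h
    · have h1 : y * x ^ (j : ℕ) ∈ Y k :=
        h ((le_sup_left : _ ≤ Y j) (Subgroup.mem_zpowers _))
      have h2 : y * x ^ (k : ℕ) ∈ Y k := (le_sup_left : _ ≤ Y k) (Subgroup.mem_zpowers _)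
      have h3 : x ^ ((j : ℤ) - k) ∈ Y k := by
        have := (Y k).mul_mem ((Y k).inv_mem h2) h1
        rwa [mul_inv_rev, mul_assoc, inv_mul_cancel_left, ← zpow_natCast, ← zpow_natCast,
          ← zpow_neg, ← zpow_add, add_comm, ← sub_eq_add_neg] at this
      have h4 := hYW k _ h3 (W.zpow_mem hxW _)
      have h5 : (p : ℤ) ∣ (j : ℤ) - k := by
        by_contra hpm
        exact hxz (mem_of_pow_mem_of_zpow_mem hp hxpZ h4 hpm)
      have : (j : ℕ) = k := by
        have hj := j.2
        have hk := k.2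
        have := Int.eq_zero_of_abs_lt_dvd h5 (by rw [abs_lt]; omega)
        omega
      rw [Fin.ext this]
    · exact absurd (hXW b' (h ((le_sup_left : _ ≤ Y j) (Subgroup.mem_zpowers _)))) (hyx j)
    · have h1 := h (Subgroup.mem_zpowers (x * cond b 1 z))
      exact absurd (hYW k _ h1 (hXW b (Subgroup.mem_zpowers _))) (hXZ b)
    · rw [hXX b b' h]

end Antichain

/-! ### Automorphisms that fix a maximal subgroup pointwise. -/

section Automorphism

variable {G : Type*} [Group G] {p : ℕ}

theorem exists_zpow_mul_eq {M : Subgroup G} [M.Normal] {c : G}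
    (hM : M ⊔ Subgroup.zpowers c = ⊤) (g : G) : ∃ n : ℤ, ∃ m ∈ M, g = c ^ n * m := by
  have hg : g ∈ Subgroup.zpowers c ⊔ M := by rw [sup_comm, hM]; trivial
  obtain ⟨a, ha, m, hm, rfl⟩ := Subgroup.mem_sup_of_normal_right.mp hg
  obtain ⟨n, rfl⟩ := Subgroup.mem_zpowers_iff.mp ha
  exact ⟨n, m, hm, rfl⟩

theorem mul_zpow_mul_inv_mem_centralizer {M : Subgroup G} [M.Normal] {c u : G}
    (hu : ∀ m ∈ M, Commute u m) (k : ℤ) :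
    (c * u) ^ k * (c ^ k)⁻¹ ∈ Subgroup.centralizer (M : Set G) := by
  have huE : u ∈ Subgroup.centralizer (M : Set G) :=
    Subgroup.mem_centralizer_iff.mpr fun m hm => ((hu m hm).eq).symm
  have h1 : QuotientGroup.mk' (Subgroup.centralizer (M : Set G)) u = 1 :=
    (QuotientGroup.eq_one_iff u).mpr huE
  refine (QuotientGroup.eq_one_iff _).mp ?_
  change QuotientGroup.mk' (Subgroup.centralizer (M : Set G)) _ = 1
  rw [map_mul, map_inv, map_zpow, map_zpow, map_mul, h1, mul_one, mul_inv_cancel]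

/-- Twisting by a central element of order `p` of a normal subgroup `M` of index `p`: there is an
automorphism of order `p` that is the identity on `M` and maps `c` to `c * u`. -/
theorem exists_mulAut_orderOf_eq [Finite G] (hp : p.Prime) {M : Subgroup G} [M.Normal] {c u : G}
    (hc : c ∉ M) (hcp : c ^ p ∈ M) (hM : M ⊔ Subgroup.zpowers c = ⊤) (huM : u ∈ M)
    (hu : ∀ m ∈ M, Commute u m) (hu1 : u ≠ 1) (hup : u ^ p = 1) (hcu : (c * u) ^ p = c ^ p) :
    ∃ φ : MulAut G, orderOf φ = p ∧ (∀ m ∈ M, φ m = m) ∧ φ c = c * u := by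
  have hdvd : ∀ n : ℤ, c ^ n ∈ M → (p : ℤ) ∣ n := fun n hn => by
    by_contra h
    exact hc (mem_of_pow_mem_of_zpow_mem hp hcp hn h)
  have hpow : ∀ n : ℤ, (p : ℤ) ∣ n → (c * u) ^ n = c ^ n := by
    rintro _ ⟨k, rfl⟩
    rw [zpow_mul, zpow_mul, zpow_natCast, zpow_natCast, hcu]
  choose n m hm hnm using exists_zpow_mul_eq hM
  let f : G → G := fun g => (c * u) ^ n g * m g
  -- The value does not depend on the chosen decomposition: two exponents of `c` differ by a
  -- multiple of p, where the powers of `c * u` and `c` agree.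
  have hf : ∀ (k : ℤ), ∀ l ∈ M, f (c ^ k * l) = (c * u) ^ k * l := by
    intro k l hl
    set g := c ^ k * l with hg
    have h1 : c ^ (n g - k) = l * (m g)⁻¹ := by
      rw [eq_mul_inv_iff_mul_eq, sub_eq_neg_add, zpow_add, mul_assoc, ← hnm g, hg, zpow_neg,
        inv_mul_cancel_left]
    have h2 : c ^ (n g - k) ∈ M := h1 ▸ M.mul_mem hl (M.inv_mem (hm g))
    have h3 := hpow _ (hdvd _ h2)
    rw [h1] at h3
    have h4 : (c * u) ^ (n g) = (c * u) ^ k * (l * (m g)⁻¹) := by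
      rw [← h3, ← zpow_add]; congr 1; ring
    change (c * u) ^ n g * m g = _
    rw [h4, mul_assoc, inv_mul_cancel_right]
  let F : G →* G := MonoidHom.mk' f (by
    intro a b
    obtain ⟨i, s, hs, rfl⟩ := exists_zpow_mul_eq hM a
    obtain ⟨j, t, ht, rfl⟩ := exists_zpow_mul_eq hM b
    have hs' : (c ^ j)⁻¹ * s * c ^ j ∈ M := by
      simpa using (inferInstance : M.Normal).conj_mem s hs (c ^ j)⁻¹
    have e1 : c ^ i * s * (c ^ j * t) = c ^ (i + j) * ((c ^ j)⁻¹ * s * c ^ j * t) := by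
      rw [zpow_add]; group
    rw [e1, hf _ _ (M.mul_mem hs' ht), hf _ _ hs, hf _ _ ht]
    -- Multiplicativity holds because (cu)^j and c^j differ by `e`, which centralizes M and so
    -- induces no extra conjugation on `s`.
    obtain ⟨e, he⟩ : ∃ e, e = (c * u) ^ j * (c ^ j)⁻¹ := ⟨_, rfl⟩
    have heM := mul_zpow_mul_inv_mem_centralizer (M := M) (c := c) hu j
    rw [← he] at heM
    have hes : s * e = e * s := Subgroup.mem_centralizer_iff.mp heM s hs
    have hcuj : (c * u) ^ j = e * c ^ j := by rw [he, inv_mul_cancel_right]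
    rw [zpow_add, hcuj]
    calc (c * u) ^ i * (e * c ^ j) * ((c ^ j)⁻¹ * s * c ^ j * t)
        = (c * u) ^ i * (e * s) * c ^ j * t := by group
      _ = (c * u) ^ i * s * (e * c ^ j * t) := by rw [← hes]; group)
  have hFM : ∀ l ∈ M, F l = l := fun l hl => by
    have h := hf 0 l hl
    rw [zpow_zero, zpow_zero, one_mul] at h
    exact h
  have hFc : F c = c * u := by
    have h := hf 1 1 M.one_mem
    rw [zpow_one, zpow_one, mul_one, mul_one] at h
    exact h
  have hFu : F u = u := hFM u huM
  have hinj : Function.Injective F := by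
    rw [injective_iff_map_eq_one]
    intro a ha
    obtain ⟨i, s, hs, rfl⟩ := exists_zpow_mul_eq hM a
    have h1 : (c * u) ^ i * s = 1 := (hf i s hs).symm.trans ha
    have h2 : (c * u) ^ i ∈ M := by
      rw [eq_inv_of_mul_eq_one_left h1]; exact M.inv_mem hs
    have h3 : c ^ i ∈ M := by
      have hu0 : QuotientGroup.mk' M u = 1 := (QuotientGroup.eq_one_iff u).mpr huM
      have h4 : QuotientGroup.mk' M ((c * u) ^ i) = 1 := (QuotientGroup.eq_one_iff _).mpr h2
      rw [map_zpow, map_mul, hu0, mul_one, ← map_zpow] at h4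
      exact (QuotientGroup.eq_one_iff _).mp h4
    rwa [hpow i (hdvd i h3)] at h1
  let φ : MulAut G := MulEquiv.ofBijective F (Finite.injective_iff_bijective.mp hinj)
  have hφM : ∀ l ∈ M, φ l = l := hFM
  have hφc : φ c = c * u := hFc
  refine ⟨φ, ?_, hφM, hφc⟩
  have hkM : ∀ (k : ℕ), ∀ l ∈ M, (φ ^ k) l = l := by
    intro k l hl
    induction k with
    | zero => simp
    | succ k ih => rw [pow_succ, MulAut.mul_apply, hφM l hl, ih]
  have hkc : ∀ k : ℕ, (φ ^ k) c = c * u ^ k := by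
    intro k
    induction k with
    | zero => simp
    | succ k ih => rw [pow_succ, MulAut.mul_apply, hφc, map_mul, ih, hkM k u huM, pow_succ, mul_assoc]
  have := Fact.mk hp
  refine orderOf_eq_prime ?_ ?_
  · ext a
    obtain ⟨i, s, hs, rfl⟩ := exists_zpow_mul_eq hM a
    rw [map_mul, map_zpow, hkM p s hs, hkc p, hup, mul_one, MulAut.one_apply]
  · intro h
    rw [h, MulAut.one_apply] at hφc
    exact hu1 (by simpa using hφc.symm)

/-- How the contrary hypothesis is exploited: the twist by `u` must be conjugation by some element,
which centralizes `M` because the twist fixes `M` pointwise. -/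
theorem exists_conj_eq_of_forall_inner [Finite G] (hp : p.Prime)
    (hinn : ∀ φ : MulAut G, orderOf φ = p → IsInnerAut φ) {M : Subgroup G} [M.Normal] {c u : G}
    (hc : c ∉ M) (hcp : c ^ p ∈ M) (hM : M ⊔ Subgroup.zpowers c = ⊤) (huM : u ∈ M)
    (hu : ∀ m ∈ M, Commute u m) (hu1 : u ≠ 1) (hup : u ^ p = 1) (hcu : (c * u) ^ p = c ^ p) :
    ∃ x, (∀ m ∈ M, Commute x m) ∧ x * c * x⁻¹ = c * u := by
  obtain ⟨φ, hφ, hφM, hφc⟩ := exists_mulAut_orderOf_eq hp hc hcp hM huM hu hu1 hup hcu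
  obtain ⟨x, hx⟩ := hinn φ hφ
  refine ⟨x, fun m hm => ?_, by rw [← hx, hφc]⟩
  have := (hx m).symm.trans (hφM m hm)
  exact mul_inv_eq_iff_eq_mul.mp this

end Automorphism

/-! ### Abelian thin groups. -/

section Abelianization

variable {p : ℕ}

/-- Otherwise all elements of order p lie in one cyclic group, and an element `g` of maximal order
generates: if h^p is a power of `g`, it is a power of g^p, so `h` differs from a power of `g` by an
element of order dividing p. -/
theorem exists_independent_of_not_isCyclic {Q : Type*} [CommGroup Q] [Finite Q] (hp : p.Prime)
    (hQ : IsPGroup p Q) (hc : ¬ IsCyclic Q) :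
    ∃ x z : Q, x ^ p = 1 ∧ z ^ p = 1 ∧ z ≠ 1 ∧ x ∉ Subgroup.zpowers z := by
  by_contra! hcon
  obtain ⟨g, hg⟩ := Monoid.exists_orderOf_eq_exponent (G := Q) Monoid.ExponentExists.of_finite
  refine hc ⟨g, fun h => ?_⟩
  have := Fact.mk hp
  have hg1 : g ≠ 1 := by
    rintro rfl
    rw [orderOf_one] at hg
    have := Monoid.exp_eq_one_iff.mp hg.symm
    exact hc inferInstance
  obtain ⟨n, hn⟩ := IsPGroup.iff_orderOf.mp hQ g
  obtain ⟨n, rfl⟩ : ∃ k, n = k + 1 := by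
    refine Nat.exists_eq_succ_of_ne_zero ?_
    rintro rfl
    rw [pow_zero, orderOf_eq_one_iff] at hn
    exact hg1 hn
  have hz1 : g ^ p ^ n ≠ 1 := by
    intro h
    have := orderOf_dvd_of_pow_eq_one h
    rw [hn, Nat.pow_dvd_pow_iff_le_right hp.one_lt] at this
    omega
  have hzp : (g ^ p ^ n) ^ p = 1 := by rw [← pow_mul, ← pow_succ, ← hn, pow_orderOf_eq_one]
  refine mem_of_pow_mem_imp_mem hQ (H := Subgroup.zpowers g) (fun h hh => ?_) h
  obtain ⟨k, hk⟩ := Subgroup.mem_zpowers_iff.mp hh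
  -- Otherwise the order of `h` would exceed the exponent, which is the order of `g`.
  have hdvd : (p : ℤ) ∣ k := by
    have h1 : g ^ (k * (p ^ n : ℕ)) = 1 := by
      rw [zpow_mul, hk, zpow_natCast, ← pow_mul, ← pow_succ', ← hn, hg]
      exact Monoid.pow_exponent_eq_one h
    have h2 := orderOf_dvd_iff_zpow_eq_one.mpr h1
    rw [hn, pow_succ'] at h2
    push_cast at h2
    exact (mul_dvd_mul_iff_right (pow_ne_zero n (by exact_mod_cast hp.ne_zero))).mp h2
  obtain ⟨j, rfl⟩ := hdvd
  have h3 : (h * (g ^ j)⁻¹) ^ p = 1 := by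
    rw [mul_pow, inv_pow, ← zpow_natCast (g ^ j), ← zpow_mul, mul_comm j, hk, mul_inv_cancel]
  have h4 := hcon _ _ h3 hzp hz1
  have h5 : h * (g ^ j)⁻¹ ∈ Subgroup.zpowers g :=
    (Subgroup.zpowers_le.mpr (Subgroup.pow_mem _ (Subgroup.mem_zpowers g) _)) h4
  exact ((Subgroup.zpowers g).mul_mem_cancel_right
    ((Subgroup.zpowers g).inv_mem (Subgroup.zpow_mem _ (Subgroup.mem_zpowers g) _))).mp h5

/-- Absorption shows that the group generated by two independent elements of order p contains every
p-th root of its elements, so it is everything. -/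
theorem exists_generators_of_comm {Q : Type*} [CommGroup Q] (hp : p.Prime)
    (hQ : IsThinPGroup p Q) (hc : ¬ IsCyclic Q) :
    ∃ a b : Q, Subgroup.zpowers a ⊔ Subgroup.zpowers b = ⊤ ∧ ∀ g : Q, g ^ p = 1 := by
  have := hQ.finite
  obtain ⟨x, z, hxp, hzp, hz1, hxz⟩ := exists_independent_of_not_isCyclic hp hQ.isPGroup hc
  have hcen : ∀ g : Q, g ∈ Subgroup.center Q := fun g =>
    Subgroup.mem_center_iff.mpr fun h => mul_comm h g
  set H := Subgroup.zpowers x ⊔ Subgroup.zpowers z with hH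
  have hxH : x ∈ H := (le_sup_left : _ ≤ H) (Subgroup.mem_zpowers x)
  have hzH : z ∈ H := (le_sup_right : _ ≤ H) (Subgroup.mem_zpowers z)
  have hHp : H ≤ (powMonoidHom p : Q →* Q).ker := by
    rw [hH, sup_le_iff, Subgroup.zpowers_le, Subgroup.zpowers_le]
    exact ⟨hxp, hzp⟩
  have hcomm : ∀ (N : Subgroup Q) (y g : Q), ⁅g, y⁆ ∈ N := fun N y g => by
    rw [commutatorElement_eq_one_iff_mul_comm.mpr (mul_comm g y)]; exact N.one_mem
  have habs : ∀ x' ∈ H, ∀ z' ∈ H, x' ∉ Subgroup.zpowers z' → z' ≠ 1 → ∀ y : Q,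
      y ^ p ∈ Subgroup.zpowers z' → y ∈ H := by
    intro x' hx' z' hz' hxz' hz1' y hy
    refine (sup_le ?_ ?_ : Subgroup.zpowers x' ⊔ Subgroup.zpowers z' ≤ H)
      (mem_of_central_independent hp hQ (hcen x') (hcen z') (hHp hx') (hHp hz') hz1' hxz' hy
        (hcomm _ y))
    · exact Subgroup.zpowers_le.mpr hx'
    · exact Subgroup.zpowers_le.mpr hz'
  have htop : ∀ g : Q, g ∈ H := by
    refine mem_of_pow_mem_imp_mem hQ.isPGroup (fun y hy => ?_)
    -- If w ≠ 1, then `x` and `z` cannot both lie in ⟨w⟩, so one of them is independent of `w` and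
    -- absorption applies with `w` in the role of `z`.
    set w := y ^ p with hw
    by_cases hw1 : w = 1
    · exact habs x hxH z hzH hxz hz1 y (by rw [← hw, hw1]; exact Subgroup.one_mem _)
    by_cases hxw : x ∈ Subgroup.zpowers w
    · have hzw : z ∉ Subgroup.zpowers w := by
        intro hzw
        obtain ⟨j, hj⟩ := Subgroup.mem_zpowers_iff.mp hzw
        have hwz : w ∈ Subgroup.zpowers z := by
          refine mem_of_pow_mem_of_zpow_mem hp (m := j) ?_ ?_ ?_
          · rw [show w ^ p = 1 from hHp hy]; exact Subgroup.one_mem _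
          · rw [hj]; exact Subgroup.mem_zpowers z
          · rintro ⟨k, rfl⟩
            rw [zpow_mul, zpow_natCast, show w ^ p = 1 from hHp hy, one_zpow] at hj
            exact hz1 hj.symm
        exact hxz ((Subgroup.zpowers_le.mpr hwz) hxw)
      exact habs z hzH w hy hzw hw1 y (Subgroup.mem_zpowers w)
    · exact habs x hxH w hy hxw hw1 y (Subgroup.mem_zpowers w)
  exact ⟨x, z, (Subgroup.eq_top_iff' H).mpr htop, fun g => hHp (htop g)⟩

end Abelianization

/-- The lower central series of `G`, with `lcs G 0 = ⊤`. -/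
abbrev lcs (G : Type*) [Group G] (n : ℕ) : Subgroup G := (⊤ : Subgroup G).lowerCentralSeries n

/-! ### Normal subgroups and the lower central series. -/

section LowerCentralSeries

variable {G : Type*} [Group G] {p : ℕ}

theorem commutator_mem_lcs_succ {i : ℕ} {y : G} (hy : y ∈ lcs G i) (g : G) :
    ⁅y, g⁆ ∈ lcs G (i + 1) :=
  Subgroup.commutator_mem_commutator hy (Subgroup.mem_top g)

theorem commutator_mem_lcs_succ' {i : ℕ} {y : G} (hy : y ∈ lcs G i) (g : G) :
    ⁅g, y⁆ ∈ lcs G (i + 1) := by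
  rw [← commutatorElement_inv]
  exact Subgroup.inv_mem _ (commutator_mem_lcs_succ hy g)

theorem lcs_succ_le_iff {i : ℕ} {K : Subgroup G} :
    lcs G (i + 1) ≤ K ↔ ∀ y ∈ lcs G i, ∀ g, ⁅y, g⁆ ∈ K := by
  rw [lcs, Subgroup.lowerCentralSeries_succ, Subgroup.commutator_le]
  simp

theorem commute_mk_iff {K : Subgroup G} [K.Normal] {x y : G} :
    Commute (QuotientGroup.mk' K x) (QuotientGroup.mk' K y) ↔ ⁅x, y⁆ ∈ K := by
  rw [← commutatorElement_eq_one_iff_commute, ← map_commutatorElement]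
  exact QuotientGroup.eq_one_iff _

theorem mk_mem_center_iff {K : Subgroup G} [K.Normal] {x : G} :
    QuotientGroup.mk' K x ∈ Subgroup.center (G ⧸ K) ↔ ∀ g, ⁅x, g⁆ ∈ K := by
  rw [Subgroup.mem_center_iff]
  refine ⟨fun h g => commute_mk_iff.mp (h _).symm, fun h q => ?_⟩
  obtain ⟨g, rfl⟩ := QuotientGroup.mk'_surjective K q
  exact (commute_mk_iff.mpr (h g)).eq.symm

theorem mk_eq_one_iff {K : Subgroup G} [K.Normal] {x : G} :
    QuotientGroup.mk' K x = 1 ↔ x ∈ K := QuotientGroup.eq_one_iff x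

theorem mk_mem_zpowers_iff {K : Subgroup G} [K.Normal] {x y : G} :
    QuotientGroup.mk' K x ∈ Subgroup.zpowers (QuotientGroup.mk' K y) ↔
      x ∈ Subgroup.zpowers y ⊔ K := by
  rw [← MonoidHom.map_zpowers, ← Subgroup.mem_comap, Subgroup.comap_map_eq, QuotientGroup.ker_mk']

/-- Taking commutators with G repeatedly pushes the error term down the series until nilpotency
kills it. -/
theorem lcs_le_of_le_sup_succ [Group.IsNilpotent G] {i : ℕ} {N : Subgroup G} [N.Normal]
    (h : lcs G i ≤ N ⊔ lcs G (i + 1)) : lcs G i ≤ N := by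
  have hstep : ∀ k, lcs G (i + k) ≤ N ⊔ lcs G (i + k + 1) := by
    intro k
    induction k with
    | zero => exact h
    | succ k ih =>
      refine lcs_succ_le_iff.mpr fun y hy g => ?_
      obtain ⟨n, hn, l, hl, rfl⟩ := Subgroup.mem_sup_of_normal_left.mp (ih hy)
      have h1 : QuotientGroup.mk' N ⁅n * l, g⁆ = QuotientGroup.mk' N ⁅l, g⁆ := by
        rw [map_commutatorElement, map_commutatorElement, map_mul, mk_eq_one_iff.mpr hn, one_mul]
      have h2 : ⁅n * l, g⁆ * ⁅l, g⁆⁻¹ ∈ N := by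
        rw [← mk_eq_one_iff, map_mul, map_inv, h1, mul_inv_cancel]
      rw [← inv_mul_cancel_right ⁅n * l, g⁆ ⁅l, g⁆]
      exact Subgroup.mul_mem_sup h2 (commutator_mem_lcs_succ hl g)
  have hall : ∀ k, lcs G i ≤ N ⊔ lcs G (i + k) := by
    intro k
    induction k with
    | zero => exact le_sup_right
    | succ k ih => exact ih.trans (sup_le le_sup_left (hstep k))
  obtain ⟨n, hn⟩ := Subgroup.nilpotent_iff_lowerCentralSeries.mp ‹Group.IsNilpotent G›
  have h1 : lcs G (i + n) = ⊥ :=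
    le_bot_iff.mp (hn ▸ Subgroup.lowerCentralSeries_antitone _ (Nat.le_add_left n i))
  simpa [h1] using hall n

/-- Modulo the term after that of ⁅y, g⁆ this commutator is central, so its p-th power is ⁅y^p, g⁆,
which is trivial there by induction. -/
theorem pow_mem_lcs_succ (hexp : ∀ g : G, g ^ p ∈ lcs G 1) :
    ∀ (i : ℕ), ∀ y ∈ lcs G i, y ^ p ∈ lcs G (i + 1) := by
  intro i
  induction i with
  | zero => exact fun y _ => hexp y
  | succ i ih =>
    let K := lcs G (i + 1 + 1)
    have hcen : ∀ y ∈ lcs G (i + 1), QuotientGroup.mk' K y ∈ Subgroup.center (G ⧸ K) :=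
      fun y hy => mk_mem_center_iff.mpr fun g => commutator_mem_lcs_succ hy g
    let S : Subgroup G :=
      { carrier := {y | y ∈ lcs G (i + 1) ∧ y ^ p ∈ K}
        one_mem' := ⟨Subgroup.one_mem _, by rw [one_pow]; exact Subgroup.one_mem _⟩
        inv_mem' := fun {y} hy =>
          ⟨Subgroup.inv_mem _ hy.1, by rw [inv_pow]; exact Subgroup.inv_mem _ hy.2⟩
        mul_mem' := fun {y y'} hy hy' => by
          refine ⟨Subgroup.mul_mem _ hy.1 hy'.1, ?_⟩
          rw [← mk_eq_one_iff, map_pow, map_mul,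
            (commute_of_mem_center (hcen y hy.1) _).mul_pow, ← map_pow, ← map_pow,
            mk_eq_one_iff.mpr hy.2, mk_eq_one_iff.mpr hy'.2, one_mul] }
    have hS : lcs G (i + 1) ≤ S := by
      refine lcs_succ_le_iff.mpr fun y hy g => ⟨commutator_mem_lcs_succ hy g, ?_⟩
      rw [← mk_eq_one_iff, map_pow]
      obtain ⟨w, hw⟩ : ∃ w, w = QuotientGroup.mk' K ⁅y, g⁆ := ⟨_, rfl⟩
      have hwc : ∀ q, Commute w q := by
        rw [hw]; exact commute_of_mem_center (hcen _ (commutator_mem_lcs_succ hy g))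
      have h1 : QuotientGroup.mk' K y * QuotientGroup.mk' K g =
          w * QuotientGroup.mk' K g * QuotientGroup.mk' K y := by
        rw [hw, map_commutatorElement, commutatorElement_def]; group
      have h2 : ∀ n : ℕ, QuotientGroup.mk' K y ^ n * QuotientGroup.mk' K g =
          w ^ n * QuotientGroup.mk' K g * QuotientGroup.mk' K y ^ n := by
        intro n
        induction n with
        | zero => simp
        | succ n ihn =>
          rw [pow_succ, mul_assoc, h1, mul_assoc w, ← mul_assoc _ w, ← ((hwc _).pow_right n).eq,
            mul_assoc, ← mul_assoc (_ ^ n), ihn, pow_succ' w]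
          simp only [mul_assoc]
      have h3 := h2 p
      rw [← map_pow, (commute_of_mem_center (hcen _ (ih y hy)) _).eq, mul_assoc] at h3
      rw [← hw]
      exact (right_eq_mul.mp h3)
    exact fun y hy => (hS hy).2

theorem mem_of_generators_mem {a b : G}
    (hab : Subgroup.zpowers a ⊔ Subgroup.zpowers b ⊔ lcs G 1 = ⊤) {H : Subgroup G}
    (ha : a ∈ H) (hb : b ∈ H) (hl : lcs G 1 ≤ H) (g : G) : g ∈ H := by
  have : (⊤ : Subgroup G) ≤ H := by
    rw [← hab, sup_le_iff, sup_le_iff, Subgroup.zpowers_le, Subgroup.zpowers_le]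
    exact ⟨⟨ha, hb⟩, hl⟩
  exact this trivial

theorem commutator_mem_of_generators {a b : G}
    (hab : Subgroup.zpowers a ⊔ Subgroup.zpowers b ⊔ lcs G 1 = ⊤) {K : Subgroup G} [K.Normal]
    {x : G} (ha : ⁅a, x⁆ ∈ K) (hb : ⁅b, x⁆ ∈ K) (hl : ∀ y ∈ lcs G 1, ⁅y, x⁆ ∈ K) (g : G) :
    ⁅g, x⁆ ∈ K := by
  have := mem_of_generators_mem hab
    (H := (Subgroup.centralizer {QuotientGroup.mk' K x}).comap (QuotientGroup.mk' K))
    (Subgroup.mem_centralizer_singleton_iff.mpr (commute_mk_iff.mpr ha).eq)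
    (Subgroup.mem_centralizer_singleton_iff.mpr (commute_mk_iff.mpr hb).eq)
    (fun y hy => Subgroup.mem_centralizer_singleton_iff.mpr (commute_mk_iff.mpr (hl y hy)).eq) g
  exact commute_mk_iff.mp (Subgroup.mem_centralizer_singleton_iff.mp this)

/-- Modulo the right-hand side the generators commute with each other and with γ_1, so the quotient
is abelian. -/
theorem lcs_one_le_zpowers_sup {a b : G}
    (hab : Subgroup.zpowers a ⊔ Subgroup.zpowers b ⊔ lcs G 1 = ⊤) :
    lcs G 1 ≤ Subgroup.zpowers ⁅a, b⁆ ⊔ lcs G 2 := by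
  have hab1 : ⁅a, b⁆ ∈ lcs G 1 := commutator_mem_lcs_succ (i := 0) trivial b
  set K := Subgroup.zpowers ⁅a, b⁆ ⊔ lcs G 2 with hK
  have hKn : K.Normal := normal_zpowers_sup fun t => commutator_mem_lcs_succ' hab1 t
  have hl : ∀ y ∈ lcs G 1, ∀ g, ⁅y, g⁆ ∈ K := fun y hy g =>
    (le_sup_right : lcs G 2 ≤ K) (commutator_mem_lcs_succ hy g)
  have habK : ⁅a, b⁆ ∈ K := (le_sup_left : _ ≤ K) (Subgroup.mem_zpowers _)
  have hcent : ∀ x : G, ⁅a, x⁆ ∈ K → ⁅b, x⁆ ∈ K → ∀ g : G, ⁅g, x⁆ ∈ K := fun x ha hb g =>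
    commutator_mem_of_generators hab ha hb (fun y hy => hl y hy x) g
  have hinv : ∀ {x y : G}, ⁅x, y⁆ ∈ K → ⁅y, x⁆ ∈ K := fun {x y} h => by
    rw [← commutatorElement_inv]; exact K.inv_mem h
  have hself : ∀ x : G, ⁅x, x⁆ ∈ K := fun x => by rw [commutatorElement_self]; exact K.one_mem
  have ha := hcent a (hself a) (hinv habK)
  have hb := hcent b habK (hself b)
  exact lcs_succ_le_iff.mpr fun y _ g => hcent g (hinv (ha g)) (hinv (hb g)) y

/-- If `b` were redundant it could be replaced by 1, and then ⁅a, 1⁆ = 1 would generate γ_1 modulo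
γ_2. -/
theorem not_mem_zpowers_sup_of_generators [Group.IsNilpotent G] (hne : lcs G 1 ≠ ⊥) {a b : G}
    (hab : Subgroup.zpowers a ⊔ Subgroup.zpowers b ⊔ lcs G 1 = ⊤) :
    b ∉ Subgroup.zpowers a ⊔ lcs G 1 := by
  intro hb
  have h1 : Subgroup.zpowers a ⊔ Subgroup.zpowers 1 ⊔ lcs G 1 = ⊤ := by
    rw [Subgroup.zpowers_one_eq_bot, sup_bot_eq, Subgroup.eq_top_iff']
    exact mem_of_generators_mem hab ((le_sup_left : _ ≤ Subgroup.zpowers a ⊔ lcs G 1)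
      (Subgroup.mem_zpowers a)) hb le_sup_right
  have h2 := lcs_one_le_zpowers_sup h1
  rw [commutatorElement_one_right, Subgroup.zpowers_one_eq_bot] at h2
  exact hne (le_bot_iff.mp (lcs_le_of_le_sup_succ h2))

theorem exists_generators [Group.IsNilpotent G] (hp : p.Prime) (hG : IsThinPGroup p G)
    (hne : lcs G 1 ≠ ⊥) :
    ∃ a b : G, Subgroup.zpowers a ⊔ Subgroup.zpowers b ⊔ lcs G 1 = ⊤ ∧
      ∀ g : G, g ^ p ∈ lcs G 1 := by
  have hl : lcs G 1 = commutator G := Subgroup.top_lowerCentralSeries_one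
  have hmap : ∀ H : Subgroup G, H.map (QuotientGroup.mk' (commutator G)) = ⊤ →
      H ⊔ lcs G 1 = ⊤ := by
    intro H hH
    have := congrArg (Subgroup.comap (QuotientGroup.mk' (commutator G))) hH
    rwa [Subgroup.comap_map_eq, QuotientGroup.ker_mk', Subgroup.comap_top, ← hl] at this
  have hcyc : ¬ IsCyclic (Abelianization G) := by
    rintro ⟨q, hq⟩
    obtain ⟨a, rfl⟩ := QuotientGroup.mk'_surjective (commutator G) q
    have h1 : Subgroup.zpowers a ⊔ lcs G 1 = ⊤ := by
      refine hmap _ ?_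
      rw [MonoidHom.map_zpowers]
      exact (Subgroup.eq_top_iff' _).mpr hq
    exact not_mem_zpowers_sup_of_generators hne (a := a) (b := 1) (by simpa using h1)
      (Subgroup.one_mem _)
  obtain ⟨x, z, h1, h2⟩ := exists_generators_of_comm (Q := Abelianization G) hp
    (isThinPGroup_quotient hG (commutator G)) hcyc
  obtain ⟨a, rfl⟩ := QuotientGroup.mk'_surjective (commutator G) x
  obtain ⟨b, rfl⟩ := QuotientGroup.mk'_surjective (commutator G) z
  refine ⟨a, b, hmap _ ?_, fun g => ?_⟩
  · rw [Subgroup.map_sup, MonoidHom.map_zpowers, MonoidHom.map_zpowers]; exact h1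
  · rw [hl, ← mk_eq_one_iff, map_pow]; exact h2 _

/-- A normal subgroup of a thin group that lies in a term of the lower central series but not in
the next one contains the next one. -/
theorem lcs_succ_le_of_not_le [Group.IsNilpotent G] (hp : p.Prime) (hG : IsThinPGroup p G)
    (hexp : ∀ g : G, g ^ p ∈ lcs G 1) {i : ℕ} {N : Subgroup G} [hN : N.Normal]
    (hNi : N ≤ lcs G i) (hNi' : ¬ N ≤ lcs G (i + 1)) : lcs G (i + 1) ≤ N := by
  by_contra hcon
  have hfin := hG.finite
  obtain ⟨x, hxN, hxl⟩ := SetLike.not_le_iff_exists.mp hNi'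
  -- Maximality of `K` makes γ_{i+1}/K central of order p in G/K, while `x` becomes central of order
  -- p outside it; absorption then puts γ_i inside Nγ_{i+1}.
  obtain ⟨K, hle, hK⟩ := (Set.toFinite {K : Subgroup G | K.Normal ∧ K < lcs G (i + 1)}).exists_le_maximal
    (a := N ⊓ lcs G (i + 1)) ⟨inferInstance, inf_lt_right.mpr hcon⟩
  obtain ⟨hKn, hKlt⟩ := hK.prop
  -- Elements of the deepest term not inside `K` are central modulo `K`.
  obtain ⟨m, hm1, hm2⟩ : ∃ m, ¬ lcs G (i + 1 + m) ≤ K ∧ lcs G (i + 1 + (m + 1)) ≤ K := by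
    by_contra! h
    have hall : ∀ m, ¬ lcs G (i + 1 + m) ≤ K := by
      intro m
      induction m with
      | zero => exact hKlt.not_ge
      | succ m ih => exact h m ih
    obtain ⟨n, hn⟩ := Subgroup.nilpotent_iff_lowerCentralSeries.mp ‹Group.IsNilpotent G›
    refine hall n ((Subgroup.lowerCentralSeries_antitone _ (Nat.le_add_left n (i + 1))).trans ?_)
    rw [hn]; exact bot_le
  obtain ⟨z, hzl, hzK⟩ := SetLike.not_le_iff_exists.mp hm1
  have hzc : ∀ g, ⁅z, g⁆ ∈ K := fun g => hm2 (commutator_mem_lcs_succ hzl g)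
  have hzl' : z ∈ lcs G (i + 1) :=
    Subgroup.lowerCentralSeries_antitone _ (Nat.le_add_right _ _) hzl
  have hzp : z ^ p ∈ K := hm2 (pow_mem_lcs_succ hexp _ z hzl)
  have hLz : Subgroup.zpowers z ⊔ K = lcs G (i + 1) := by
    have hle' : Subgroup.zpowers z ⊔ K ≤ lcs G (i + 1) :=
      sup_le (Subgroup.zpowers_le.mpr hzl') hKlt.le
    by_contra hne
    have hn : (Subgroup.zpowers z ⊔ K).Normal := normal_zpowers_sup fun t => by
      rw [← commutatorElement_inv]; exact K.inv_mem (hzc t)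
    exact hzK (hK.le_of_ge ⟨hn, lt_of_le_of_ne hle' hne⟩ le_sup_right
      ((le_sup_left : _ ≤ Subgroup.zpowers z ⊔ K) (Subgroup.mem_zpowers z)))
  have hxK : ∀ g, ⁅x, g⁆ ∈ K := fun g =>
    hle ⟨(Subgroup.commutator_le_left N ⊤) (Subgroup.commutator_mem_commutator hxN trivial),
      commutator_mem_lcs_succ (hNi hxN) g⟩
  have hxp : x ^ p ∈ K := hle ⟨N.pow_mem hxN p, pow_mem_lcs_succ hexp _ x (hNi hxN)⟩
  have hsup : lcs G i ≤ N ⊔ lcs G (i + 1) := by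
    intro y hy
    have h := mem_of_central_independent hp (isThinPGroup_quotient hG K)
      (x := QuotientGroup.mk' K x) (z := QuotientGroup.mk' K z) (y := QuotientGroup.mk' K y)
      (mk_mem_center_iff.mpr hxK) (mk_mem_center_iff.mpr hzc)
      (by rw [← map_pow, mk_eq_one_iff]; exact hxp) (by rw [← map_pow, mk_eq_one_iff]; exact hzp)
      (by rwa [Ne, mk_eq_one_iff]) (by rwa [mk_mem_zpowers_iff, hLz])
      (by rw [← map_pow, mk_mem_zpowers_iff, hLz]; exact pow_mem_lcs_succ hexp _ y hy)
      (by
        intro q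
        obtain ⟨g, rfl⟩ := QuotientGroup.mk'_surjective K q
        rw [← map_commutatorElement, mk_mem_zpowers_iff, hLz]
        exact commutator_mem_lcs_succ' hy g)
    rw [← MonoidHom.map_zpowers, ← MonoidHom.map_zpowers, ← Subgroup.map_sup,
      ← Subgroup.mem_comap, Subgroup.comap_map_eq, QuotientGroup.ker_mk', sup_assoc, hLz] at h
    exact (sup_le_sup_right (Subgroup.zpowers_le.mpr hxN) _) h
  exact hcon ((Subgroup.lowerCentralSeries_antitone _ (Nat.le_succ i)).trans
    (lcs_le_of_le_sup_succ hsup))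

theorem le_lcs_or_lcs_le [Group.IsNilpotent G] (hp : p.Prime) (hG : IsThinPGroup p G)
    (hexp : ∀ g : G, g ^ p ∈ lcs G 1) (i : ℕ) (N : Subgroup G) [N.Normal] :
    N ≤ lcs G i ∨ lcs G i ≤ N := by
  induction i with
  | zero => exact Or.inl le_top
  | succ i ih =>
    rcases ih with h | h
    · by_cases h' : N ≤ lcs G (i + 1)
      · exact Or.inl h'
      · exact Or.inr (lcs_succ_le_of_not_le hp hG hexp h h')
    · exact Or.inr ((Subgroup.lowerCentralSeries_antitone _ (Nat.le_succ i)).trans h)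

end LowerCentralSeries

/-! ### The exponent of the last but one nontrivial term. -/

section Exponent

variable {G : Type*} [Group G] {p : ℕ}

/-- The three subgroups lemma modulo γ_{i+2}; its hypotheses hold because ⁅γ_i, G, G⁆ = γ_{i+2}. -/
theorem commutator_mem_lcs_add_two {i : ℕ} {y w : G} (hy : y ∈ lcs G i) (hw : w ∈ lcs G 1) :
    ⁅y, w⁆ ∈ lcs G (i + 2) := by
  let π := QuotientGroup.mk' (lcs G (i + 2))
  have hsurj : (⊤ : Subgroup G).map π = ⊤ :=
    Subgroup.map_top_of_surjective _ (QuotientGroup.mk'_surjective _)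
  have h1 : ⁅⁅(⊤ : Subgroup (G ⧸ lcs G (i + 2))), (lcs G i).map π⁆, (⊤ : Subgroup (G ⧸ lcs G (i + 2)))⁆ = ⊥ := by
    rw [← hsurj, ← Subgroup.map_commutator, ← Subgroup.map_commutator,
      Subgroup.commutator_comm ⊤ (lcs G i), ← Subgroup.lowerCentralSeries_succ,
      ← Subgroup.lowerCentralSeries_succ, eq_bot_iff, Subgroup.map_le_iff_le_comap,
      MonoidHom.comap_bot, QuotientGroup.ker_mk']
  have h2 := Subgroup.commutator_commutator_eq_bot_of_rotate h1
    (by rwa [Subgroup.commutator_comm ((lcs G i).map π)])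
  have h3 : ⁅π w, π y⁆ = 1 := by
    rw [← Subgroup.mem_bot, ← h2]
    refine Subgroup.commutator_mem_commutator ?_ (Subgroup.mem_map_of_mem _ hy)
    rw [← hsurj, ← Subgroup.map_commutator]
    exact Subgroup.mem_map_of_mem _ hw
  rw [← commutatorElement_inv, inv_mem_iff, ← mk_eq_one_iff, map_commutatorElement]
  exact h3

theorem commute_of_mem_lcs {n : ℕ} (hbot : lcs G (n + 3) = ⊥) {y w : G} (hy : y ∈ lcs G n)
    (hw : w ∈ lcs G 2) : Commute y w := by
  have h1 : ⁅⁅(⊤ : Subgroup G), lcs G n⁆, lcs G 1⁆ = ⊥ := by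
    rw [Subgroup.commutator_comm ⊤, eq_bot_iff, Subgroup.commutator_le, ← hbot]
    exact fun y hy w hw => commutator_mem_lcs_add_two (i := n + 1) hy hw
  have h2 : ⁅⁅lcs G n, lcs G 1⁆, (⊤ : Subgroup G)⁆ = ⊥ := by
    have h3 : ⁅lcs G n, lcs G 1⁆ ≤ lcs G (n + 2) :=
      Subgroup.commutator_le.mpr fun y hy w hw => commutator_mem_lcs_add_two hy hw
    rw [eq_bot_iff, ← hbot]
    exact Subgroup.commutator_mono h3 le_rfl
  have h3 := Subgroup.commutator_commutator_eq_bot_of_rotate h1 h2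
  rw [← commutatorElement_eq_one_iff_commute, ← inv_eq_one, commutatorElement_inv,
    ← Subgroup.mem_bot, ← h3]
  exact Subgroup.commutator_mem_commutator hw hy

/-- The last but one nontrivial term of the lower central series has exponent `p`. -/
theorem pow_eq_one_of_mem_lcs [Group.IsNilpotent G] (hp : p.Prime) (hodd : Odd p) {a b : G}
    (hab : Subgroup.zpowers a ⊔ Subgroup.zpowers b ⊔ lcs G 1 = ⊤)
    (hexp : ∀ g : G, g ^ p ∈ lcs G 1) {n : ℕ} (hne : lcs G (n + 2) ≠ ⊥)
    (hbot : lcs G (n + 3) = ⊥) : ∀ u ∈ lcs G (n + 1), u ^ p = 1 := by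
  have hcomm : ∀ u ∈ lcs G (n + 1), ∀ v ∈ lcs G (n + 1), Commute u v := by
    intro u hu v hv
    rw [← commutatorElement_eq_one_iff_commute, ← Subgroup.mem_bot, ← hbot]
    exact commutator_mem_lcs_add_two hu
      (Subgroup.lowerCentralSeries_antitone _ (Nat.le_add_left 1 n) hv)
  have hlast : ∀ s ∈ lcs G (n + 2), s ^ p = 1 ∧ ∀ g, Commute s g := by
    intro s hs
    refine ⟨?_, fun g => ?_⟩
    · rw [← Subgroup.mem_bot, ← hbot]; exact pow_mem_lcs_succ hexp _ s hs
    · rw [← commutatorElement_eq_one_iff_commute, ← Subgroup.mem_bot, ← hbot]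
      exact commutator_mem_lcs_succ hs g
  let P : G → Prop := fun g => ∀ y ∈ lcs G n, ⁅y, g⁆ ^ p = 1
  -- Compare two values of (y g y⁻¹)^p: it equals g^p because `y` commutes with γ_2, and ⁅y, g⁆^p
  -- g^p because `g` and ⁅y, g⁆ commute up to a central element of order dividing p.
  have hP1 : ∀ g, g ^ p ∈ lcs G 2 → P g := by
    intro g hg y hy
    have hw : ⁅y, g⁆ ∈ lcs G (n + 1) := commutator_mem_lcs_succ hy g
    obtain ⟨hsp, hsc⟩ := hlast _ (commutator_mem_lcs_succ' hw g)
    have h1 := mul_pow_of_commutator_central hp hodd (w := ⁅y, g⁆) (g := g) (s := ⁅g, ⁅y, g⁆⁆)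
      (by rw [commutatorElement_def g]; group) (hsc _) (hsc _) hsp
    have h2 : (⁅y, g⁆ * g) ^ p = g ^ p := by
      rw [show ⁅y, g⁆ * g = y * g * y⁻¹ by rw [commutatorElement_def]; group, conj_pow,
        (commute_of_mem_lcs hbot hy hg).eq, mul_inv_cancel_right]
    rw [h2] at h1
    exact right_eq_mul.mp h1
  have hP2 : ∀ g h, P g → P h → P (g * h) := by
    intro g h hg hh y hy
    have e : ⁅y, g * h⁆ = ⁅y, g⁆ * (g * ⁅y, h⁆ * g⁻¹) := by
      simp only [commutatorElement_def]; group
    have hconj : g * ⁅y, h⁆ * g⁻¹ ∈ lcs G (n + 1) :=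
      (inferInstance : (lcs G (n + 1)).Normal).conj_mem _ (commutator_mem_lcs_succ hy h) g
    rw [e, (hcomm _ (commutator_mem_lcs_succ hy g) _ hconj).mul_pow, conj_pow, hg y hy, hh y hy]
    simp
  obtain ⟨y₀, hy₀, h₀, hyh⟩ : ∃ y ∈ lcs G 1, ∃ h : G, ⁅y, h⁆ ∉ lcs G 3 := by
    by_contra! hcon
    have h1 : lcs G 2 ≤ lcs G 3 := lcs_succ_le_iff.mpr hcon
    have h2 : lcs G 2 ≤ ⊥ := lcs_le_of_le_sup_succ (h1.trans le_sup_right)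
    exact hne (le_bot_iff.mp
      ((Subgroup.lowerCentralSeries_antitone _ (Nat.le_add_left 2 n)).trans h2))
  -- If g^p were outside γ_2, it would generate γ_1 modulo γ_2, so `y₀` would be a power of `g`
  -- modulo γ_2 and commute with `g` modulo γ_3.
  have hP3 : ∀ g, ⁅y₀, g⁆ ∉ lcs G 3 → P g := by
    intro g hg
    refine hP1 g ?_
    by_contra hgp
    have hab1 : ⁅a, b⁆ ∈ lcs G 1 := commutator_mem_lcs_succ (i := 0) trivial b
    have hsp := pow_mem_lcs_succ hexp 1 _ hab1
    have hle := lcs_one_le_zpowers_sup hab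
    have hs : ⁅a, b⁆ ∈ Subgroup.zpowers (g ^ p) ⊔ lcs G 2 := by
      obtain ⟨s, hs, l, hl, hsl⟩ := Subgroup.mem_sup_of_normal_right.mp (hle (hexp g))
      obtain ⟨k, rfl⟩ := Subgroup.mem_zpowers_iff.mp hs
      refine mem_of_pow_mem_of_zpow_mem hp (m := k) (Subgroup.mem_sup_right hsp) ?_ ?_
      · rw [eq_mul_inv_of_mul_eq hsl]
        exact Subgroup.mul_mem_sup (Subgroup.mem_zpowers _) (Subgroup.inv_mem _ hl)
      · intro hk
        exact hgp (hsl ▸ Subgroup.mul_mem _ (zpow_mem_of_pow_mem hsp hk) hl)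
    have hy₀' := (hle.trans (sup_le (Subgroup.zpowers_le.mpr hs) le_sup_right)) hy₀
    obtain ⟨s, hs, l, hl, rfl⟩ := Subgroup.mem_sup_of_normal_right.mp hy₀'
    obtain ⟨k, rfl⟩ := Subgroup.mem_zpowers_iff.mp hs
    refine hg (commute_mk_iff.mp ?_)
    rw [map_mul, map_zpow, map_pow]
    exact (((Commute.refl _).pow_left p).zpow_left k).mul_left
      (commute_mk_iff.mpr (commutator_mem_lcs_succ hl g))
  -- The centralizer of `y₀` modulo γ_3 is proper, so each of its elements is a product of two
  -- elements outside it.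
  have hP : ∀ g, P g := by
    intro g
    by_cases hg : ⁅y₀, g⁆ ∈ lcs G 3
    · have h1 : ⁅y₀, g * h₀⁆ ∉ lcs G 3 := by
        intro h
        rw [← commute_mk_iff] at h hg hyh
        rw [map_mul] at h
        have := hg.inv_right.mul_right h
        rw [inv_mul_cancel_left] at this
        exact hyh this
      have h2 : ⁅y₀, h₀⁻¹⁆ ∉ lcs G 3 := by
        intro h
        rw [← commute_mk_iff] at h hyh
        rw [map_inv] at h
        exact hyh (Commute.inv_right_iff.mp h)
      have := hP2 _ _ (hP3 _ h1) (hP3 _ h2)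
      rwa [mul_inv_cancel_right] at this
    · exact hP3 g hg
  let S : Subgroup G :=
    { carrier := {u | u ∈ lcs G (n + 1) ∧ u ^ p = 1}
      one_mem' := ⟨Subgroup.one_mem _, one_pow p⟩
      inv_mem' := fun {u} hu => ⟨Subgroup.inv_mem _ hu.1, by rw [inv_pow, hu.2, inv_one]⟩
      mul_mem' := fun {u v} hu hv => ⟨Subgroup.mul_mem _ hu.1 hv.1, by
        rw [(hcomm u hu.1 v hv.1).mul_pow, hu.2, hv.2, one_mul]⟩ }
  have hS : lcs G (n + 1) ≤ S :=
    lcs_succ_le_iff.mpr fun y hy g => ⟨commutator_mem_lcs_succ hy g, hP g y hy⟩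
  exact fun u hu => (hS hu).2

end Exponent

/-! ### Abelian groups and groups of class two. -/

section Small

variable {G : Type*} [Group G] {p : ℕ}

/-- In an abelian `p`-group of order greater than `p`, not all automorphisms of order `p` are
inner. -/
theorem not_forall_inner_of_comm [Finite G] (hp : p.Prime) (hG : IsPGroup p G)
    (hcard : p < Nat.card G) (hcomm : ∀ x y : G, Commute x y) :
    ¬ ∀ φ : MulAut G, orderOf φ = p → IsInnerAut φ := by
  intro hinn
  have := Fact.mk hp
  have : Nontrivial G := Finite.one_lt_card_iff_nontrivial.mp (hp.one_lt.trans hcard)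
  obtain ⟨M, hM, -⟩ := (eq_top_or_exists_le_coatom (⊥ : Subgroup G)).resolve_left bot_ne_top
  have hMn : M.Normal := ⟨fun m hm g => by
    rwa [(hcomm g m).eq, mul_inv_cancel_right]⟩
  obtain ⟨c, hc⟩ : ∃ c, c ∉ M := by
    by_contra! h
    exact hM.1 ((Subgroup.eq_top_iff' M).mpr h)
  have hsup : ∀ d, d ∉ M → M ⊔ Subgroup.zpowers d = ⊤ := fun d hd =>
    hM.2 _ (lt_of_le_of_ne le_sup_left fun h =>
      hd (h ▸ Subgroup.mem_sup_right (Subgroup.mem_zpowers d)))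
  have hcp : c ^ p ∈ M := by
    by_contra h
    obtain ⟨k, m, hm, hk⟩ := exists_zpow_mul_eq (hsup _ h) c
    obtain ⟨j, hj⟩ := hG c
    have h1 : c ^ (1 - p * k : ℤ) ∈ M := by
      have : c ^ (1 - p * k : ℤ) = m := by
        rw [sub_eq_neg_add, zpow_add, zpow_one, zpow_neg, zpow_mul, zpow_natCast]
        exact inv_mul_eq_of_eq_mul hk
      exact this ▸ hm
    have h2 : c ^ (p ^ j : ℤ) ∈ M := by
      rw [← Nat.cast_pow, zpow_natCast, hj]; exact M.one_mem
    have h3 : IsCoprime (1 - p * k : ℤ) (p ^ j : ℤ) :=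
      IsCoprime.pow_right ⟨1, k, by ring⟩
    obtain ⟨r, s, hrs⟩ := h3
    refine hc ?_
    have := M.mul_mem (M.zpow_mem h1 r) (M.zpow_mem h2 s)
    rwa [← zpow_mul, ← zpow_mul, ← zpow_add, mul_comm _ r, mul_comm _ s, hrs, zpow_one] at this
  have hMbot : M ≠ ⊥ := by
    rintro rfl
    have h1 := hsup c hc
    rw [bot_sup_eq] at h1
    have h2 : orderOf c = Nat.card G := by
      rw [← Nat.card_zpowers, h1, Subgroup.card_top]
    rw [← h2] at hcard
    exact absurd (Nat.le_of_dvd hp.pos (orderOf_dvd_of_pow_eq_one (Subgroup.mem_bot.mp hcp)))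
      (not_le.mpr hcard)
  have : Nontrivial M := (Subgroup.nontrivial_iff_ne_bot M).mpr hMbot
  have hdvd : p ∣ Nat.card M := by
    obtain ⟨n, hn, h⟩ := (hG.to_subgroup M).nontrivial_iff_card.mp this
    rw [h]; exact dvd_pow_self p hn.ne'
  obtain ⟨u, hu⟩ := exists_prime_orderOf_dvd_card' p hdvd
  have hup : (u : G) ^ p = 1 := by
    have := pow_orderOf_eq_one u
    rw [hu] at this
    exact_mod_cast congrArg Subtype.val this
  have hu1 : (u : G) ≠ 1 := by
    intro h
    rw [OneMemClass.coe_eq_one] at h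
    rw [h, orderOf_one] at hu
    exact hp.one_lt.ne hu
  obtain ⟨x, -, hx⟩ := exists_conj_eq_of_forall_inner hp hinn hc hcp (hsup c hc) u.2
    (fun m _ => hcomm _ m) hu1 hup (by rw [(hcomm _ _).mul_pow, hup, mul_one])
  rw [(hcomm x c).eq, mul_inv_cancel_right] at hx
  exact hu1 (left_eq_mul.mp hx)

theorem exists_conj_eq_of_generators [Finite G] [Group.IsNilpotent G] (hp : p.Prime)
    (hodd : Odd p) (hinn : ∀ φ : MulAut G, orderOf φ = p → IsInnerAut φ)
    (hexp : ∀ g : G, g ^ p ∈ lcs G 1) (hne : lcs G 1 ≠ ⊥) {m c u : G}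
    (hmc : Subgroup.zpowers m ⊔ Subgroup.zpowers c ⊔ lcs G 1 = ⊤)
    (huM : u ∈ Subgroup.zpowers m ⊔ lcs G 1)
    (hu : ∀ y ∈ Subgroup.zpowers m ⊔ lcs G 1, Commute u y) (hu1 : u ≠ 1) (hup : u ^ p = 1)
    (huc : ⁅u, c⁆ ∈ Subgroup.center G) (hucp : ⁅u, c⁆ ^ p = 1) :
    ∃ x, (∀ y ∈ Subgroup.zpowers m ⊔ lcs G 1, Commute x y) ∧ x * c * x⁻¹ = c * u := by
  have hn : (Subgroup.zpowers m ⊔ lcs G 1).Normal :=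
    normal_zpowers_sup fun t => commutator_mem_lcs_succ (i := 0) trivial m
  refine exists_conj_eq_of_forall_inner hp hinn (not_mem_zpowers_sup_of_generators hne hmc)
    (Subgroup.mem_sup_right (hexp c)) ?_ huM hu hu1 hup ?_
  · rw [← hmc, sup_assoc, sup_assoc, sup_comm (lcs G 1)]
  · have := commute_of_mem_center huc
    rw [mul_pow_of_commutator_central hp hodd (s := ⁅u, c⁆)
      (by rw [commutatorElement_def]; group) (this c) (this u) hucp, hup, mul_one]

theorem not_forall_inner_of_class_two [Finite G] [Group.IsNilpotent G] (hp : p.Prime)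
    (hodd : Odd p) {a b : G} (hab : Subgroup.zpowers a ⊔ Subgroup.zpowers b ⊔ lcs G 1 = ⊤)
    (hexp : ∀ g : G, g ^ p ∈ lcs G 1) (hne : lcs G 1 ≠ ⊥) (hbot : lcs G 2 = ⊥) :
    ¬ ∀ φ : MulAut G, orderOf φ = p → IsInnerAut φ := by
  intro hinn
  have hcen : ∀ s ∈ lcs G 1, s ∈ Subgroup.center G := fun s hs =>
    Subgroup.mem_center_iff.mpr fun g => by
      rw [← commutatorElement_eq_one_iff_mul_comm, ← Subgroup.mem_bot, ← hbot]
      exact commutator_mem_lcs_succ' hs g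
  have hexp1 : ∀ s ∈ lcs G 1, s ^ p = 1 := fun s hs => by
    rw [← Subgroup.mem_bot, ← hbot]; exact pow_mem_lcs_succ hexp 1 s hs
  have hcomm : ∀ x y : G, ⁅x, y⁆ ∈ lcs G 1 := fun x y => commutator_mem_lcs_succ (i := 0) trivial y
  -- Some generator has order p: γ_1 is generated by ⁅a, b⁆, of order dividing p, so if a^p ≠ 1 then
  -- b^p is a power of a^p, and `b` can be corrected by a power of `a`. The twist by such a `u` ∉
  -- γ_1 is not inner, since conjugation changes `c` only by elements of γ_1.
  obtain ⟨u, c, huc, hup⟩ : ∃ u c : G,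
      Subgroup.zpowers u ⊔ Subgroup.zpowers c ⊔ lcs G 1 = ⊤ ∧ u ^ p = 1 := by
    by_cases hap : a ^ p = 1
    · exact ⟨a, b, hab, hap⟩
    have hle : lcs G 1 ≤ Subgroup.zpowers (a ^ p) := by
      have h1 := lcs_one_le_zpowers_sup hab
      rw [hbot, sup_bot_eq] at h1
      refine h1.trans (Subgroup.zpowers_le.mpr ?_)
      have hsp := hexp1 _ (hcomm a b)
      obtain ⟨k, hk⟩ := Subgroup.mem_zpowers_iff.mp (h1 (hexp a))
      refine mem_of_pow_mem_of_zpow_mem hp (m := k) ?_ ?_ ?_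
      · rw [hsp]; exact Subgroup.one_mem _
      · rw [hk]; exact Subgroup.mem_zpowers _
      · rintro ⟨j, rfl⟩
        rw [zpow_mul, zpow_natCast, hsp, one_zpow] at hk
        exact hap hk.symm
    obtain ⟨k, hk⟩ := Subgroup.mem_zpowers_iff.mp (hle (hexp b))
    refine ⟨b * a ^ (-k), a, ?_, ?_⟩
    · rw [Subgroup.eq_top_iff']
      have ha : a ∈ Subgroup.zpowers (b * a ^ (-k)) ⊔ Subgroup.zpowers a ⊔ lcs G 1 :=
        Subgroup.mem_sup_left (Subgroup.mem_sup_right (Subgroup.mem_zpowers a))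
      refine mem_of_generators_mem hab ha ?_ le_sup_right
      rw [← Subgroup.mul_mem_cancel_right _ (Subgroup.zpow_mem _ ha (-k))]
      exact Subgroup.mem_sup_left (Subgroup.mem_sup_left (Subgroup.mem_zpowers _))
    · have hs := hcomm (a ^ (-k)) b
      have hsc := commute_of_mem_center (hcen _ hs)
      rw [mul_pow_of_commutator_central hp hodd (s := ⁅a ^ (-k), b⁆)
        (by rw [commutatorElement_def]; group) (hsc _) (hsc _) (hexp1 _ hs), ← hk,
        ← zpow_natCast, ← zpow_natCast, ← zpow_mul, ← zpow_mul, ← zpow_add]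
      rw [show (p : ℤ) * k + -k * p = 0 by ring, zpow_zero]
  have hu : ∀ y ∈ Subgroup.zpowers u ⊔ lcs G 1, Commute u y := by
    have : Subgroup.zpowers u ⊔ lcs G 1 ≤ Subgroup.centralizer {u} := by
      rw [sup_le_iff, Subgroup.zpowers_le]
      exact ⟨Subgroup.mem_centralizer_singleton_iff.mpr rfl, fun y hy =>
        Subgroup.mem_centralizer_singleton_iff.mpr (commute_of_mem_center (hcen y hy) u).eq⟩
    exact fun y hy => (Subgroup.mem_centralizer_singleton_iff.mp (this hy)).symm
  have hul : u ∉ lcs G 1 := fun h =>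
    not_mem_zpowers_sup_of_generators hne (by rwa [sup_comm (Subgroup.zpowers u)] at huc)
      (Subgroup.mem_sup_right h)
  obtain ⟨x, -, hx⟩ := exists_conj_eq_of_generators hp hodd hinn hexp hne huc
    (Subgroup.mem_sup_left (Subgroup.mem_zpowers u)) hu
    (fun h => hul (h ▸ Subgroup.one_mem _)) hup (hcen _ (hcomm u c)) (hexp1 _ (hcomm u c))
  refine hul ?_
  rw [← inv_mul_eq_of_eq_mul hx]
  have := hcomm c⁻¹ x
  rwa [commutatorElement_def, inv_inv, mul_assoc, mul_assoc, ← mul_assoc x] at this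

end Small

/-! ### Class at least three: conjugators modulo the second centre. -/

section ClassAtLeastThree

variable {G : Type*} [Group G] {p : ℕ}

theorem mem_last_lcs (hexp : ∀ g : G, g ^ p ∈ lcs G 1) {n : ℕ} (hbot : lcs G (n + 3) = ⊥) {s : G}
    (hs : s ∈ lcs G (n + 2)) : s ^ p = 1 ∧ s ∈ Subgroup.center G := by
  refine ⟨?_, Subgroup.mem_center_iff.mpr fun g => ?_⟩
  · rw [← Subgroup.mem_bot, ← hbot]; exact pow_mem_lcs_succ hexp _ s hs
  · rw [← commutatorElement_eq_one_iff_mul_comm, ← Subgroup.mem_bot, ← hbot]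
    exact commutator_mem_lcs_succ' hs g

theorem mem_center_of_commute_generators {m c u : G}
    (hmc : Subgroup.zpowers m ⊔ Subgroup.zpowers c ⊔ lcs G 1 = ⊤)
    (hu : ∀ y ∈ Subgroup.zpowers m ⊔ lcs G 1, Commute u y) (hc : Commute u c) :
    u ∈ Subgroup.center G := by
  rw [Subgroup.mem_center_iff]
  intro g
  exact Subgroup.mem_centralizer_singleton_iff.mp <| mem_of_generators_mem hmc
    (H := Subgroup.centralizer {u})
    (Subgroup.mem_centralizer_singleton_iff.mpr
      (hu m (Subgroup.mem_sup_left (Subgroup.mem_zpowers m))).eq.symm)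
    (Subgroup.mem_centralizer_singleton_iff.mpr hc.eq.symm)
    (fun y hy => Subgroup.mem_centralizer_singleton_iff.mpr
      (hu y (Subgroup.mem_sup_right hy)).eq.symm) g

theorem commutator_mem_of_conj_eq {m c x u : G}
    (hmc : Subgroup.zpowers m ⊔ Subgroup.zpowers c ⊔ lcs G 1 = ⊤) {K : Subgroup G} [K.Normal]
    (hx : ∀ y ∈ Subgroup.zpowers m ⊔ lcs G 1, Commute x y) (hxc : x * c * x⁻¹ = c * u)
    (hu : u ∈ K) (g : G) : ⁅x, g⁆ ∈ K := by
  rw [← commutatorElement_inv, inv_mem_iff]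
  have hM : ∀ y ∈ Subgroup.zpowers m ⊔ lcs G 1, ⁅y, x⁆ ∈ K := fun y hy => by
    rw [(hx y hy).symm.commutator_eq]; exact K.one_mem
  refine commutator_mem_of_generators hmc
    (hM m (Subgroup.mem_sup_left (Subgroup.mem_zpowers m))) ?_
    (fun y hy => hM y (Subgroup.mem_sup_right hy)) g
  rw [← commutatorElement_inv, inv_mem_iff, commutatorElement_def, hxc]
  exact (inferInstance : K.Normal).conj_mem u hu c

theorem zpow_conj_eq {x c u : G} (hxu : Commute x u) (hxc : x * c * x⁻¹ = c * u) (i : ℤ) :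
    x ^ i * c * (x ^ i)⁻¹ = c * u ^ i := by
  have h1 : c⁻¹ * x * c = u * x := by
    rw [mul_assoc, inv_mul_eq_iff_eq_mul, ← mul_assoc, ← hxc, inv_mul_cancel_right]
  have h2 : c⁻¹ * x ^ i * c = u ^ i * x ^ i := by
    rw [← hxu.symm.mul_zpow, ← h1]
    have := conj_zpow (a := c⁻¹) (b := x) (i := i)
    rw [inv_inv] at this
    exact this.symm
  rw [mul_inv_eq_iff_eq_mul, mul_assoc, ← h2, mul_assoc, mul_inv_cancel_left]

theorem pow_mem_center_of_conj_eq {m c x u : G}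
    (hmc : Subgroup.zpowers m ⊔ Subgroup.zpowers c ⊔ lcs G 1 = ⊤)
    (hx : ∀ y ∈ Subgroup.zpowers m ⊔ lcs G 1, Commute x y) (hxc : x * c * x⁻¹ = c * u)
    (hxu : Commute x u) (hup : u ^ p = 1) : x ^ p ∈ Subgroup.center G := by
  refine mem_center_of_commute_generators hmc (fun y hy => (hx y hy).pow_left p) ?_
  have := zpow_conj_eq hxu hxc p
  rw [zpow_natCast, zpow_natCast, hup, mul_one] at this
  exact mul_inv_eq_iff_eq_mul.mp this

theorem exists_mem_lcs_commute [Finite G] [Group.IsNilpotent G] (hp : p.Prime) (hodd : Odd p)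
    (hG : IsThinPGroup p G) (hinn : ∀ φ : MulAut G, orderOf φ = p → IsInnerAut φ)
    (hexp : ∀ g : G, g ^ p ∈ lcs G 1) {n : ℕ} (hne : lcs G (n + 2) ≠ ⊥)
    (hbot : lcs G (n + 3) = ⊥) {m c : G}
    (hmc : Subgroup.zpowers m ⊔ Subgroup.zpowers c ⊔ lcs G 1 = ⊤) :
    ∃ u ∈ lcs G (n + 1), u ∉ Subgroup.center G ∧
      ∀ y ∈ Subgroup.zpowers m ⊔ lcs G 1, Commute u y := by
  have hne1 : lcs G 1 ≠ ⊥ := fun h => hne (le_bot_iff.mp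
    (h ▸ Subgroup.lowerCentralSeries_antitone _ (Nat.le_add_left 1 (n + 1))))
  have hlast : ∀ s ∈ lcs G (n + 2), s ^ p = 1 ∧ s ∈ Subgroup.center G :=
    fun s hs => mem_last_lcs hexp hbot hs
  obtain ⟨z, hzl, hz1⟩ := (Subgroup.bot_or_exists_ne_one _).resolve_left hne
  obtain ⟨hzp, hzc⟩ := mem_last_lcs hexp hbot hzl
  have hzcomm := commute_of_mem_center hzc
  have hzM : z ∈ Subgroup.zpowers m ⊔ lcs G 1 :=
    Subgroup.mem_sup_right (Subgroup.lowerCentralSeries_antitone _ (Nat.le_add_left 1 (n + 1)) hzl)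
  have hzc1 : ⁅z, c⁆ = 1 := (hzcomm c).commutator_eq
  obtain ⟨x, hxM, hxc⟩ := exists_conj_eq_of_generators hp hodd hinn hexp hne1 hmc hzM
    (fun y _ => hzcomm y) hz1 hzp (by rw [hzc1]; exact Subgroup.one_mem _) (by rw [hzc1, one_pow])
  have hxZ : ∀ g, ⁅x, g⁆ ∈ Subgroup.center G := commutator_mem_of_conj_eq hmc hxM hxc hzc
  have hxnot : x ∉ Subgroup.center G := by
    intro h
    rw [(commute_of_mem_center h c).eq, mul_inv_cancel_right] at hxc
    exact hz1 (left_eq_mul.mp hxc)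
  have hLn : (Subgroup.zpowers x ⊔ Subgroup.center G).Normal := normal_zpowers_sup fun t => by
    rw [← commutatorElement_inv]; exact Subgroup.inv_mem _ (hxZ t)
  have hxL : x ∈ Subgroup.zpowers x ⊔ Subgroup.center G :=
    Subgroup.mem_sup_left (Subgroup.mem_zpowers x)
  -- Either `x` itself lies in γ_{n+1}, or γ_{n+1} lies in ⟨x⟩Z(G), all of which centralizes the
  -- maximal subgroup, and any noncentral element of γ_{n+1} will do.
  rcases le_lcs_or_lcs_le hp hG hexp (n + 1) (Subgroup.zpowers x ⊔ Subgroup.center G) with h | h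
  · exact ⟨x, h hxL, hxnot, hxM⟩
  · have hnc : ¬ lcs G (n + 1) ≤ Subgroup.center G := by
      intro hle
      refine hne (le_bot_iff.mp (lcs_succ_le_iff.mpr fun y hy g => ?_))
      rw [(commute_of_mem_center (hle hy) g).commutator_eq]
      exact Subgroup.one_mem _
    obtain ⟨u, hul, huc⟩ := SetLike.not_le_iff_exists.mp hnc
    refine ⟨u, hul, huc, fun y hy => ?_⟩
    have hle : Subgroup.zpowers x ⊔ Subgroup.center G ≤ Subgroup.centralizer {y} := by
      rw [sup_le_iff, Subgroup.zpowers_le]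
      exact ⟨Subgroup.mem_centralizer_singleton_iff.mpr (hxM y hy).eq, fun s hs =>
        Subgroup.mem_centralizer_singleton_iff.mpr (commute_of_mem_center hs y).eq⟩
    exact Subgroup.mem_centralizer_singleton_iff.mp (hle (h hul))

/-- If all automorphisms of order `p` are inner, then each maximal subgroup of a thin group of class
at least three is centralized by an element moving its complement by a noncentral element of the
last but one term of the lower central series. -/
theorem exists_conj_eq_mul_lcs [Finite G] [Group.IsNilpotent G] (hp : p.Prime) (hodd : Odd p)
    (hG : IsThinPGroup p G) (hinn : ∀ φ : MulAut G, orderOf φ = p → IsInnerAut φ)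
    (hexp : ∀ g : G, g ^ p ∈ lcs G 1) {n : ℕ} (hne : lcs G (n + 2) ≠ ⊥)
    (hbot : lcs G (n + 3) = ⊥) {m c : G}
    (hmc : Subgroup.zpowers m ⊔ Subgroup.zpowers c ⊔ lcs G 1 = ⊤) :
    ∃ x u : G, u ∈ lcs G (n + 1) ∧ u ∉ Subgroup.center G ∧ u ^ p = 1 ∧
      (∀ y ∈ Subgroup.zpowers m ⊔ lcs G 1, Commute u y) ∧
      (∀ y ∈ Subgroup.zpowers m ⊔ lcs G 1, Commute x y) ∧ x * c * x⁻¹ = c * u := by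
  have hne1 : lcs G 1 ≠ ⊥ := fun h => hne (le_bot_iff.mp
    (h ▸ Subgroup.lowerCentralSeries_antitone _ (Nat.le_add_left 1 (n + 1))))
  obtain ⟨u, hul, huc, hu⟩ := exists_mem_lcs_commute hp hodd hG hinn hexp hne hbot hmc
  have hup := pow_eq_one_of_mem_lcs hp hodd hmc hexp hne hbot u hul
  have h := mem_last_lcs hexp hbot (commutator_mem_lcs_succ hul c)
  obtain ⟨x, hx, hxc⟩ := exists_conj_eq_of_generators hp hodd hinn hexp hne1 hmc
    (Subgroup.mem_sup_right (Subgroup.lowerCentralSeries_antitone _ (Nat.le_add_left 1 n) hul)) hu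
    (fun h => huc (h ▸ Subgroup.one_mem _)) hup h.2 h.1
  exact ⟨x, u, hul, huc, hup, hu, hx, hxc⟩

theorem not_forall_inner_of_class_ge_three [Finite G] [Group.IsNilpotent G] (hp : p.Prime)
    (hodd : Odd p) (hG : IsThinPGroup p G) {a b : G}
    (hab : Subgroup.zpowers a ⊔ Subgroup.zpowers b ⊔ lcs G 1 = ⊤)
    (hexp : ∀ g : G, g ^ p ∈ lcs G 1) {n : ℕ} (hne : lcs G (n + 2) ≠ ⊥)
    (hbot : lcs G (n + 3) = ⊥) :
    ¬ ∀ φ : MulAut G, orderOf φ = p → IsInnerAut φ := by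
  intro hinn
  have hgen : ∀ m c : G, (∀ H : Subgroup G, m ∈ H → c ∈ H → a ∈ H ∧ b ∈ H) →
      Subgroup.zpowers m ⊔ Subgroup.zpowers c ⊔ lcs G 1 = ⊤ := by
    intro m c h
    obtain ⟨ha, hb⟩ := h (Subgroup.zpowers m ⊔ Subgroup.zpowers c ⊔ lcs G 1)
      (Subgroup.mem_sup_left (Subgroup.mem_sup_left (Subgroup.mem_zpowers m)))
      (Subgroup.mem_sup_left (Subgroup.mem_sup_right (Subgroup.mem_zpowers c)))
    exact (Subgroup.eq_top_iff' _).mpr (mem_of_generators_mem hab ha hb le_sup_right)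
  -- The element ab lies outside the maximal subgroups of `a` and `b`, so it serves as the moved
  -- element for both and spans the third one.
  obtain ⟨c, hc⟩ : ∃ c, c = a * b := ⟨_, rfl⟩
  have hac := hgen a c fun H h1 h2 => ⟨h1, (H.mul_mem_cancel_left h1).mp (hc ▸ h2)⟩
  have hbc := hgen b c fun H h1 h2 => ⟨(H.mul_mem_cancel_right h1).mp (hc ▸ h2), h1⟩
  have hca := hgen c a fun H h1 h2 => ⟨h2, (H.mul_mem_cancel_left h2).mp (hc ▸ h1)⟩
  obtain ⟨x₁, u₁, hul₁, huc₁, hup₁, hu₁, hx₁, hxc₁⟩ :=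
    exists_conj_eq_mul_lcs hp hodd hG hinn hexp hne hbot hac
  obtain ⟨x₂, u₂, hul₂, huc₂, hup₂, hu₂, hx₂, hxc₂⟩ :=
    exists_conj_eq_mul_lcs hp hodd hG hinn hexp hne hbot hbc
  obtain ⟨x₃, u₃, hul₃, huc₃, hup₃, hu₃, hx₃, hxc₃⟩ :=
    exists_conj_eq_mul_lcs hp hodd hG hinn hexp hne hbot hca
  have hle1 : lcs G (n + 1) ≤ lcs G 1 :=
    Subgroup.lowerCentralSeries_antitone _ (Nat.le_add_left 1 n)
  -- The second centre.
  let K : Subgroup G :=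
    (Subgroup.center (G ⧸ Subgroup.center G)).comap (QuotientGroup.mk' (Subgroup.center G))
  have hKn : K.Normal := inferInstanceAs (Subgroup.comap _ _).Normal
  have hK : ∀ {x : G}, x ∈ K ↔ ∀ g, ⁅x, g⁆ ∈ Subgroup.center G := mk_mem_center_iff
  have hZK : Subgroup.center G ≤ K := fun z hz => hK.mpr fun g => by
    rw [(commute_of_mem_center hz g).commutator_eq]; exact Subgroup.one_mem _
  have hlK : ∀ u ∈ lcs G (n + 1), u ∈ K := fun u hu =>
    hK.mpr fun g => (mem_last_lcs hexp hbot (commutator_mem_lcs_succ hu g)).2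
  have hnotK : ∀ {x c u : G}, x * c * x⁻¹ = c * u → x ∈ K → u ∈ Subgroup.center G := by
    intro x c u hxc hx
    have h := hK.mp hx c
    rw [commutatorElement_def, hxc] at h
    have := (inferInstance : (Subgroup.center G).Normal).conj_mem _ h c⁻¹
    simpa [mul_assoc] using this
  -- Conjugating `c` by this product multiplies it by u₁^i u₂^j up to a central factor, so u₁^i u₂^j
  -- is central. As `u₂` commutes with `b` and `u₁` with `a`, the factor u₁^i commutes with both and
  -- is central; hence so is u₂^j.
  have hindep : ∀ i j : ℤ, ∀ k ∈ K, Commute (x₁ ^ i * (x₂ ^ j * k)) c →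
      (p : ℤ) ∣ i ∧ (p : ℤ) ∣ j := by
    intro i j k hk hcomm
    have e₁ := zpow_conj_eq (hx₁ _ (Subgroup.mem_sup_right (hle1 hul₁))) hxc₁ i
    have e₂ := zpow_conj_eq (hx₂ _ (Subgroup.mem_sup_right (hle1 hul₂))) hxc₂ j
    have hζ := commute_of_mem_center (hK.mp hk c)
    obtain ⟨ζ, hζe⟩ : ∃ ζ, ζ = ⁅k, c⁆ := ⟨_, rfl⟩
    rw [← hζe] at hζ
    have hkc : k * c * k⁻¹ = ζ * c := by rw [hζe, commutatorElement_def]; group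
    have hcu : (x₁ ^ i * u₂ ^ j) = u₂ ^ j * x₁ ^ i :=
      ((hx₁ _ (Subgroup.mem_sup_right (hle1 hul₂))).zpow_left i).zpow_right j
    have h1 : c = ζ * (c * (u₁ ^ i * u₂ ^ j)) := by
      calc c = (x₁ ^ i * (x₂ ^ j * k)) * c * (x₁ ^ i * (x₂ ^ j * k))⁻¹ := by
            rw [hcomm.eq, mul_inv_cancel_right]
        _ = x₁ ^ i * (x₂ ^ j * (k * c * k⁻¹) * (x₂ ^ j)⁻¹) * (x₁ ^ i)⁻¹ := by group
        _ = x₁ ^ i * (ζ * (x₂ ^ j * c * (x₂ ^ j)⁻¹)) * (x₁ ^ i)⁻¹ := by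
            rw [hkc, ← mul_assoc (x₂ ^ j) ζ c, ← (hζ (x₂ ^ j)).eq]; group
        _ = ζ * (x₁ ^ i * (c * u₂ ^ j) * (x₁ ^ i)⁻¹) := by
            rw [e₂, ← mul_assoc (x₁ ^ i) ζ, ← (hζ (x₁ ^ i)).eq]; group
        _ = ζ * ((x₁ ^ i * c * (x₁ ^ i)⁻¹) * u₂ ^ j) := by
            rw [← mul_assoc (x₁ ^ i) c, mul_assoc (x₁ ^ i * c) _ (x₁ ^ i)⁻¹,
              mul_assoc (x₁ ^ i * c) (x₁ ^ i)⁻¹, (inv_mul_eq_iff_eq_mul.mpr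
                (by rw [← mul_assoc, hcu, mul_inv_cancel_right]) :
                (x₁ ^ i)⁻¹ * u₂ ^ j = u₂ ^ j * (x₁ ^ i)⁻¹)]
        _ = ζ * (c * (u₁ ^ i * u₂ ^ j)) := by rw [e₁, mul_assoc c]
    have h2 : ζ * (u₁ ^ i * u₂ ^ j) = 1 := by
      rw [← mul_assoc, (hζ c).eq, mul_assoc] at h1
      exact left_eq_mul.mp h1
    have hζZ : ζ ∈ Subgroup.center G := hζe ▸ hK.mp hk c
    have h3 : u₁ ^ i * u₂ ^ j ∈ Subgroup.center G := by
      rw [eq_inv_of_mul_eq_one_right h2]; exact Subgroup.inv_mem _ hζZ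
    have h4 : u₁ ^ i ∈ Subgroup.center G := by
      refine mem_center_of_commute_generators hab (fun y hy => (hu₁ y hy).zpow_left i) ?_
      have hb : b ∈ Subgroup.zpowers b ⊔ lcs G 1 :=
        Subgroup.mem_sup_left (Subgroup.mem_zpowers b)
      have h5 := (commute_of_mem_center h3 b).mul_left ((hu₂ b hb).zpow_left (-j))
      rwa [zpow_neg, mul_inv_cancel_right] at h5
    have h5 : u₂ ^ j ∈ Subgroup.center G := (Subgroup.mul_mem_cancel_left _ h4).mp h3
    constructor
    · by_contra hi
      exact huc₁ (mem_of_pow_mem_of_zpow_mem hp (hup₁ ▸ Subgroup.one_mem _) h4 hi)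
    · by_contra hj
      exact huc₂ (mem_of_pow_mem_of_zpow_mem hp (hup₂ ▸ Subgroup.one_mem _) h5 hj)
  have hx₁K := commutator_mem_of_conj_eq hac hx₁ hxc₁ (hlK _ hul₁)
  have hx₂K := commutator_mem_of_conj_eq hbc hx₂ hxc₂ (hlK _ hul₂)
  have hx₃K := commutator_mem_of_conj_eq hca hx₃ hxc₃ (hlK _ hul₃)
  have hxp₁ := hZK (pow_mem_center_of_conj_eq hac hx₁ hxc₁
    (hx₁ _ (Subgroup.mem_sup_right (hle1 hul₁))) hup₁)
  have hxp₂ := hZK (pow_mem_center_of_conj_eq hbc hx₂ hxc₂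
    (hx₂ _ (Subgroup.mem_sup_right (hle1 hul₂))) hup₂)
  have hxp₃ := hZK (pow_mem_center_of_conj_eq hca hx₃ hxc₃
    (hx₃ _ (Subgroup.mem_sup_right (hle1 hul₃))) hup₃)
  have hn₂ : (Subgroup.zpowers x₂ ⊔ K).Normal := normal_zpowers_sup fun t => by
    rw [← commutatorElement_inv]; exact K.inv_mem (hx₂K t)
  have h12 : x₁ ∉ Subgroup.zpowers x₂ ⊔ K := by
    intro h
    obtain ⟨s, hs, k, hk, hsk⟩ := Subgroup.mem_sup_of_normal_right.mp h
    obtain ⟨j, rfl⟩ := Subgroup.mem_zpowers_iff.mp hs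
    -- With i = -1 the product is trivial, so it commutes with `c`.
    have := (hindep (-1) j k hk (by
      rw [hsk, zpow_neg_one, inv_mul_cancel]; exact Commute.one_left c)).1
    rw [Int.dvd_neg] at this
    exact (Nat.prime_iff_prime_int.mp hp).not_dvd_one this
  have h := mem_of_central_independent hp (isThinPGroup_quotient hG K)
    (x := QuotientGroup.mk' K x₁) (z := QuotientGroup.mk' K x₂) (y := QuotientGroup.mk' K x₃)
    (mk_mem_center_iff.mpr hx₁K) (mk_mem_center_iff.mpr hx₂K)
    (by rw [← map_pow, mk_eq_one_iff]; exact hxp₁) (by rw [← map_pow, mk_eq_one_iff]; exact hxp₂)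
    (by rw [Ne, mk_eq_one_iff]; exact fun h => huc₂ (hnotK hxc₂ h))
    (by rwa [mk_mem_zpowers_iff])
    (by rw [← map_pow, mk_eq_one_iff.mpr hxp₃]; exact Subgroup.one_mem _)
    (by
      intro q
      rw [(commute_of_mem_center (mk_mem_center_iff.mpr hx₃K) q).symm.commutator_eq]
      exact Subgroup.one_mem _)
  rw [← MonoidHom.map_zpowers, ← MonoidHom.map_zpowers, ← Subgroup.map_sup,
    ← Subgroup.mem_comap, Subgroup.comap_map_eq, QuotientGroup.ker_mk', sup_assoc] at h
  obtain ⟨s, hs, t, ht, hst⟩ := Subgroup.mem_sup_of_normal_right.mp h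
  obtain ⟨i, rfl⟩ := Subgroup.mem_zpowers_iff.mp hs
  obtain ⟨r, hr, k, hk, rfl⟩ := Subgroup.mem_sup_of_normal_right.mp ht
  obtain ⟨j, rfl⟩ := Subgroup.mem_zpowers_iff.mp hr
  obtain ⟨hi, hj⟩ := hindep i j k hk
    (hst ▸ hx₃ c (Subgroup.mem_sup_left (Subgroup.mem_zpowers c)))
  refine huc₃ (hnotK hxc₃ ?_)
  rw [← hst]
  exact K.mul_mem (zpow_mem_of_pow_mem hxp₁ hi) (K.mul_mem (zpow_mem_of_pow_mem hxp₂ hj) hk)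

end ClassAtLeastThree

end ThinPGroup

open ThinPGroup in
/-- A finite thin `p`-group of order greater than `p`, `p` odd, has a noninner automorphism of order
`p`. -/
theorem theorem3p1 (p : ℕ) (hp : p.Prime) (hp_odd : Odd p)
    {G : Type*} [Group G] (hG : IsThinPGroup p G) (hcard : p < Nat.card G) :
    ∃ φ : MulAut G, orderOf φ = p ∧ ¬ IsInnerAut φ := by
  by_contra! hinn
  have := hG.finite
  have := Fact.mk hp
  have : Group.IsNilpotent G := hG.isPGroup.isNilpotent
  by_cases h1 : lcs G 1 = ⊥
  · refine not_forall_inner_of_comm hp hG.isPGroup hcard (fun x y => ?_) hinn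
    rw [← commutatorElement_eq_one_iff_commute, ← Subgroup.mem_bot, ← h1]
    exact commutator_mem_lcs_succ (i := 0) trivial y
  obtain ⟨a, b, hab, hexp⟩ := exists_generators hp hG h1
  by_cases h2 : lcs G 2 = ⊥
  · exact not_forall_inner_of_class_two hp hp_odd hab hexp h1 h2 hinn
  -- γ_{n+2} is the last nontrivial term; it has index at least 2 because γ_2 ≠ 1.
  obtain ⟨n, hn⟩ : ∃ n, lcs G (n + 2) ≠ ⊥ ∧ lcs G (n + 3) = ⊥ := by
    by_contra! h
    have hall : ∀ n, lcs G (n + 2) ≠ ⊥ := fun n => by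
      induction n with
      | zero => exact h2
      | succ n ih => exact h n ih
    obtain ⟨n, hn⟩ := Subgroup.nilpotent_iff_lowerCentralSeries.mp this
    exact hall n (le_bot_iff.mp
      (hn ▸ Subgroup.lowerCentralSeries_antitone _ (Nat.le_add_right n 2)))
  exact not_forall_inner_of_class_ge_three hp hp_odd hG hab hexp hn.1 hn.2 hinn
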